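/- **Setting.** A *pair of globular sets* consists of two globular sets, one of sort $X$ and one of sort $Z$ (cells of dimension $0,1,2,\dots$ with sources $s$ and targets $t$ satisfying $ss=st$, $ts=tt$). *Trees.* The $2$-globe category has objects $1(n)$, $2(n)$ (globes of sort $X$ and $Z$), $f^n(1(n))$, $g^n(1(n))$ for $n\ge 0$, and one object $\xi=\tau(1(0))$; its arrows are generated by the cosources and cotargets $1(p)\to 1(n)$, $2(p)\to 2(n)$, $f^p(1(p))\to f^n(1(n))$, $g^p(1(p))\to g^n(1(n))$ $(p<n)$, and by one cosource $f^0(1(0))\to\xi$ and one cotarget $g^0(1(0))\to \xi$, with the globular relations. As arities, $1(n)$, $f^n(1(n))$, $g^n(1(n))$ denote an $n$-globe of sort $X$, $2(n)$ an $n$-globe of sort $Z$, and $\xi$ a $0$-globe of sort $X$. A *tree* is a table $a_1\leftarrow a_1'\to a_2\leftarrow a_2'\to\cdots\to a_k$ $(k\ge1)$ of objects in which each $a_l'\to a_l$ is an identity or a composite of cotargets and each $a'_l\to a_{l+1}$ is an identity or a composite of cosources; its *globular sum* is the colimit of the table in pairs of globular sets. *Theories.* In a $(2,\infty)$-magma there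 are compositions $y\circ^n_p x$ $(0\le p<n)$ of $n$-cells of the same sort with $s^n_p(y)=t^n_p(x)$, where for $p=n-1$ one has $s(y\circ x)=s(x)$ and $t(y\circ x)=t(y)$, and for $p<n-1$ one has $s(y\circ^n_px)=s(y)\circ^{n-1}_p s(x)$, $t(y\circ^n_px)=t(y)\circ^{n-1}_p t(x)$; two maps $F,H$ from the cells of sort $X$ to those of sort $Z$ that preserve dimensions, sources and targets; and a $1$-cell $\tau(x)\colon F(x)\to H(x)$ of sort $Z$ for each $0$-cell $x$ of sort $X$. No further equations are imposed. Let $\Theta_0$ be the category whose objects are trees and whose morphisms $S\to T$ are the maps of pairs of globular sets from the globular sum of $S$ to the free $(2,\infty)$-magma on the globular sum of $T$. For a category $\Theta$ under $\Theta_0$ with the same objects, an $m$-operation of sort $c$ and arity $T$ is a morphism to $T$ from the $m$-globe of sort $c$; it is *algebraic* if it is not a cell of the globular sum of $T$. Two $m$-operations of the same sort and arity are *parallel* if they have the same source and the same target (no condition if $m=0$). A pair $(P,Q)$ is *admissible* if $P$ and $Q$ are parallel and algebraic; a *lifting* of it is an $(m+1)$-operation with source $P$ and target $Q$. The *coherator*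 $\Theta^\infty_{\mathbb M^2}$ is the colimit of the sequence of theories $\Theta_0\to\Theta_1\to\cdots$ in which $\Theta_{n+1}$ is obtained from $\Theta_n$ by freely adjoining a lifting of each admissible pair of $\Theta_n$ (the lifting adjoined to a pair that comes from an earlier stage being identified with the one adjoined there). *Models.* A *globular weak $(2,\infty)$-natural transformation* is a functor $\tau\colon(\Theta^\infty_{\mathbb M^2})^{op}\to\mathrm{Sets}$ that sends the globular sums of trees to globular products (fibre products). Its values on $1(n)$ and $2(n)$ are the sets of $n$-cells $X_n$, $Z_n$ of two globular sets with the compositions $\circ^n_p$, and it provides $F,H\colon X\to Z$ and $\tau(x)\colon F(x)\to H(x)$. It has *dimension $2$* if, for all $q>2$, it equalizes the source and the target of every $q$-operation, that is, $\tau(K\circ s^q_{q-1})=\tau(K\circ t^q_{q-1})$ for every $q$-operation $K$. *Coherence data.* By a *choice of liftings* we mean a choice, in $\Theta^\infty_{\mathbb M^2}$, of liftings of the following admissible pairs, where $\Rightarrow$ leads from the source to the target, the letters denote the generic cells of the relevant trees, and in the first four items the sort is $X$ or $Z$: * whiskerings $b\circ a\Rightarrow b\circ a'$ and $b\circ a\Rightarrow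 b'\circ a$, for a generic $2$-cell $a\Rightarrow a'$, resp. $b\Rightarrow b'$; * identities $1_{b\circ a}\colon b\circ a\Rightarrow b\circ a$; * associators $a(c,b,a)\colon c\circ(b\circ a)\Rightarrow(c\circ b)\circ a$; * associators in the reverse direction $\bar a(c,b,a)\colon (c\circ b)\circ a\Rightarrow c\circ(b\circ a)$; * identities $1_{F(a)}$, $1_{H(a)}$ and $1_{\tau(x)}$; * $d_0(b,a)\colon F(b)\circ F(a)\Rightarrow F(b\circ a)$, $d_1(b,a)\colon H(b)\circ H(a)\Rightarrow H(b\circ a)$, and liftings $\bar d_0,\bar d_1$ of the reversed pairs; * $\omega(a)\colon H(a)\circ\tau(x)\Rightarrow\tau(y)\circ F(a)$ for a generic $1$-cell $a\colon x\to y$ of sort $X$, and a lifting $\bar\omega$ of the reversed pair. **Proposition.** Choices of liftings exist. For every choice of liftings: 1. There are parallel algebraic $2$-operations $P,Q$ of sort $Z$, with arity the tree of two composable generic $1$-cells of sort $X$, and a $3$-operation with source $P$ and target $Q$, such that in every model $\tau$ and for all $1$-cells $x\xrightarrow{a}y\xrightarrow{b}z$ of $X$, the values of $P$ and $Q$ at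 $(b,a)$ are, with $\cdot$ the composition $\circ^2_1$ and $*$ the composition $\circ^2_0$, the composites $$(ABCDEF)=(1_{\tau(z)}* d_0(b,a))\cdot \bar a(\tau(z),F(b),F(a))\cdot(\omega(b)* 1_{F(a)})\cdot a(H(b),\tau(y),F(a))\cdot(1_{H(b)}*\omega(a)),$$ $$(AGHF)=\omega(b\circ a)\cdot(d_1(b,a)*1_{\tau(x)})\cdot a(H(b),H(a),\tau(x))$$ from $H(b)\circ(H(a)\circ\tau(x))$ to $\tau(z)\circ F(b\circ a)$ (bracketed to the left). 2. If $\tau$ is a model of dimension $2$, then $\tau$ is a pseudo-$2$-natural transformation, in the following sense. (The coherator does not provide $X$ and $Z$ with identities of arbitrary cells. All axioms on identity $1$-cells are therefore omitted, and the axioms on identity $2$-cells concern only the $2$-cells $1_{b\circ a}$, $1_{F(a)}$, $1_{H(a)}$, $1_{\tau(x)}$.) * $X$ and $Z$ are bicategories: $\circ^2_1$ is associative; the interchange law holds; $\beta*\alpha$ is equal to both composites of whiskerings; whiskering preserves $\circ^2_1$; $1_{b\circ a}$ is idempotent and acts as a unit on whiskerings into or out of $b\circ a$; the associators are natural in each variable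 and invertible with inverse $\bar a$, and satisfy the unit laws $a(c,b,a)\cdot 1_{c\circ(b\circ a)}=a(c,b,a)$, $1_{c\circ(b\circ a)}\cdot\bar a(c,b,a)=\bar a(c,b,a)$ and the pentagon identity. * $F$ and $H$ are pseudo-$2$-functors $X\to Z$: for $G\in\{F,H\}$ with constraint $d\in\{d_0,d_1\}$, $G$ preserves $\circ^2_1$; $1_{G(a)}$ is idempotent and a unit for the $2$-cells $G(\alpha)$; $G(1_{b\circ a})=1_{G(b\circ a)}$ and $1_{G(b)}*1_{G(a)}=1_{G(b)\circ G(a)}$; $d$ is natural in both variables and invertible with inverse $\bar d$, with $1_{G(b\circ a)}\cdot d(b,a)=d(b,a)$ and $\bar d(b,a)\cdot 1_{G(b\circ a)}=\bar d(b,a)$; and $d$ is compatible with the associators: $$G(a(c,b,a))\cdot d(c,b\circ a)\cdot(1_{G(c)}*d(b,a))=d(c\circ b,a)\cdot(d(c,b)*1_{G(a)})\cdot a(G(c),G(b),G(a)).$$ * The $1$-cells $\tau(x)$ and the $2$-cells $\omega(a)$ form a pseudo-$2$-natural transformation from $F$ to $H$: $1_{\tau(x)}$ is idempotent, $1_{H(a)}*1_{\tau(x)}=1_{H(a)\circ\tau(x)}$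 and $1_{\tau(y)}*1_{F(a)}=1_{\tau(y)\circ F(a)}$ for $a\colon x\to y$; $\omega(a)$ is invertible with inverse $\bar\omega(a)$, with $\omega(a)\cdot 1_{H(a)\circ\tau(x)}=\omega(a)$ and $1_{H(a)\circ\tau(x)}\cdot\bar\omega(a)=\bar\omega(a)$; it is natural, that is, $\omega(a')\cdot(H(\alpha)*1_{\tau(x)})=(1_{\tau(y)}*F(\alpha))\cdot\omega(a)$ for every $2$-cell $\alpha\colon a\Rightarrow a'$ of $X$ with $a,a'\colon x\to y$; and the hexagon commutes: for all $1$-cells $x\xrightarrow{a}y\xrightarrow{b}z$ of $X$, $$(ABCDEF)=(AGHF).$$ -/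

import Mathlib

open CategoryTheory Opposite

universe u

namespace WeakTrans

/-! ### Globes, pairs of globular sets -/

/-- The two sorts of cells: those of the domain `X` and those of the codomain `Z`. -/
inductive Side
  | X
  | Z

/-- The `m`-cells of the `n`-globe, that is, the arrows `m ⟶ n` of the globe category:
the identity, and for `m < n` the iterated cosource (`false`) and cotarget (`true`). -/
inductive GlobeCell (n m : ℕ) : Type
  | top (h : m = n)
  | bdry (h : m < n) (ε : Bool)

theorem GlobeCell.le {n m : ℕ} : GlobeCell n m → m ≤ n
  | .top h => h.le
  | .bdry h _ => h.le

/-- The source (`false`) and target (`true`) of a cell of the globe. -/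
def GlobeCell.bd {n m : ℕ} (ε : Bool) (z : GlobeCell n (m + 1)) : GlobeCell n m :=
  .bdry z.le ε

/-- The map of globes `s^n_p` (`ε = false`), `t^n_p` (`ε = true`), or the identity if `p = n`. -/
def GlobeCell.push {p n : ℕ} (ε : Bool) (h : p ≤ n) {m : ℕ} : GlobeCell p m → GlobeCell n m
  | .top e => if hn : p = n then .top (e.trans hn) else .bdry (e ▸ lt_of_le_of_ne h hn) ε
  | .bdry e δ => .bdry (e.trans_le h) δ

theorem GlobeCell.push_top {p n : ℕ} (ε : Bool) (h : p < n) :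
    GlobeCell.push ε h.le (.top rfl) = .bdry h ε := dif_neg h.ne

/-- A pair of globular sets: `bd false` is the source and `bd true` is the target. -/
structure PairGlob where
  cell : Side → ℕ → Type
  bd : Bool → ∀ {c : Side} {m : ℕ}, cell c (m + 1) → cell c m
  globular : ∀ (ε δ δ' : Bool) {c : Side} {m : ℕ} (x : cell c (m + 2)),
    bd ε (bd δ x) = bd ε (bd δ' x)

/-- Morphisms of pairs of globular sets. -/
@[ext]
structure PairGlob.Hom (A B : PairGlob) where
  app : ∀ {c : Side} {m : ℕ}, A.cell c m → B.cell c m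
  comm : ∀ (ε : Bool) {c : Side} {m : ℕ} (x : A.cell c (m + 1)), B.bd ε (app x) = app (A.bd ε x)

def PairGlob.Hom.comp {A B C : PairGlob} (φ : A.Hom B) (ψ : B.Hom C) : A.Hom C where
  app x := ψ.app (φ.app x)
  comm ε c m x := by rw [ψ.comm, φ.comm]

/-! ### The 2-globe category and its trees -/

/-- The objects of the 2-globe category: `glob X n` and `glob Z n` are the globes `1(n)` and
`2(n)`, `fn false n` and `fn true n` are the objects `fⁿ(1(n))` and `gⁿ(1(n))`, which stand for
an `n`-cell of `X` to which the first or the second functor is applied, and `xi` stands for a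
`0`-cell of `X` at which the transformation is evaluated. -/
inductive GObj
  | glob (c : Side) (n : ℕ)
  | fn (δ : Bool) (n : ℕ)
  | xi

/-- The sort of the cells an object of the 2-globe category is an arity for. -/
def GObj.side : GObj → Side
  | glob c _ => c
  | fn _ _ => .X
  | xi => .X

/-- The dimension of the globe an object of the 2-globe category is an arity for. -/
def GObj.arityDim : GObj → ℕ
  | glob _ n => n
  | fn _ n => n
  | xi => 0

/-- `Leg false a b` (resp. `Leg true a b`) says that `a = b` or that there is an arrow `a ⟶ b` of
the 2-globe category that is a composite of cosources (resp. of cotargets). The arrows into `xi`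
are the cosource from `f⁰(1(0))` and the cotarget from `g⁰(1(0))`. -/
inductive GObj.Leg : Bool → GObj → GObj → Prop
  | glob (ε : Bool) (c : Side) {p n : ℕ} (h : p ≤ n) : Leg ε (glob c p) (glob c n)
  | fn (ε δ : Bool) {p n : ℕ} (h : p ≤ n) : Leg ε (fn δ p) (fn δ n)
  | xi (ε : Bool) : Leg ε xi xi
  | toXi (ε : Bool) : Leg ε (fn ε 0) xi

theorem GObj.Leg.side_eq {ε : Bool} {a b : GObj} (h : Leg ε a b) : a.side = b.side := by
  cases h <;> rfl

theorem GObj.Leg.dim_le {ε : Bool} {a b : GObj} (h : Leg ε a b) : a.arityDim ≤ b.arityDim := by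
  cases h <;> first | assumption | exact le_rfl

/-- The pair of globular sets represented by an object of the 2-globe category. -/
def GObj.D (a : GObj) : PairGlob where
  cell c m := {_z : GlobeCell a.arityDim m // a.side = c}
  bd ε _ _ z := ⟨z.1.bd ε, z.2⟩
  globular _ _ _ _ _ _ := rfl

/-- The map of pairs of globular sets given by an arrow of the 2-globe category. -/
def GObj.Leg.map {ε : Bool} {a b : GObj} (h : Leg ε a b) : a.D.Hom b.D where
  app z := ⟨z.1.push ε h.dim_le, h.side_eq ▸ z.2⟩
  comm δ c m z := by
    obtain ⟨z, hz⟩ := z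
    rcases z with e | ⟨e, _⟩ <;> rfl

/-- Trees of the 2-globe category, as tables
`a₁ ≥ a'₁ ≤ a₂ ≥ a'₂ ≤ ⋯ ≤ aₖ` in which the legs `a'ₗ ⟶ aₗ` are cotargets and the
legs `a'ₗ ⟶ aₗ₊₁` are cosources. -/
structure Tree where
  len : ℕ
  top : Fin (len + 1) → GObj
  bot : Fin len → GObj
  tleg : ∀ l, GObj.Leg true (bot l) (top l.castSucc)
  sleg : ∀ l, GObj.Leg false (bot l) (top l.succ)

/-- The gluing relation of the globular sum of a tree. -/
inductive Tree.Glue (T : Tree) (c : Side) (m : ℕ) :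
    (Σ l, (T.top l).D.cell c m) → (Σ l, (T.top l).D.cell c m) → Prop
  | mk (l : Fin T.len) (z : (T.bot l).D.cell c m) :
      Glue T c m ⟨l.castSucc, (T.tleg l).map.app z⟩ ⟨l.succ, (T.sleg l).map.app z⟩

/-- The globular sum of a tree: the colimit of its table in pairs of globular sets. -/
def Tree.real (T : Tree) : PairGlob where
  cell c m := Quot (T.Glue c m)
  bd ε c m := Quot.map (fun z => ⟨z.1, (T.top z.1).D.bd ε z.2⟩) (by
    rintro _ _ ⟨l, z⟩
    have := Tree.Glue.mk (T := T) l ((T.bot l).D.bd ε z)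
    rwa [← (T.tleg l).map.comm, ← (T.sleg l).map.comm] at this)
  globular ε δ δ' c m x := by
    induction x using Quot.ind
    rfl

/-- The coprojections of a globular sum. -/
def Tree.incl (T : Tree) (l : Fin (T.len + 1)) : (T.top l).D.Hom T.real where
  app z := Quot.mk _ ⟨l, z⟩
  comm _ _ _ _ := rfl

theorem Tree.incl_glue (T : Tree) (l : Fin T.len) {c : Side} {m : ℕ}
    (z : (T.bot l).D.cell c m) :
    (T.incl l.castSucc).app ((T.tleg l).map.app z) = (T.incl l.succ).app ((T.sleg l).map.app z) :=
  Quot.sound (Tree.Glue.mk l z)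

/-- Maps out of a globular sum. -/
def Tree.desc (T : Tree) {A : PairGlob} (φ : ∀ l, (T.top l).D.Hom A)
    (h : ∀ (l : Fin T.len) {c : Side} {m : ℕ} (z : (T.bot l).D.cell c m),
      (φ l.castSucc).app ((T.tleg l).map.app z) = (φ l.succ).app ((T.sleg l).map.app z)) :
    T.real.Hom A where
  app := Quot.lift (fun z => (φ z.1).app z.2) (by rintro _ _ ⟨l, z⟩; exact h l z)
  comm ε c m x := by
    induction x using Quot.ind
    exact (φ _).comm _ _

/-- The tree with one entry. -/
def Tree.single (a : GObj) : Tree where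
  len := 0
  top _ := a
  bot l := l.elim0
  tleg l := l.elim0
  sleg l := l.elim0

/-- The top cell of an entry of a tree. -/
def Tree.gen (T : Tree) (l : Fin (T.len + 1)) : T.real.cell (T.top l).side (T.top l).arityDim :=
  (T.incl l).app ⟨.top rfl, rfl⟩

/-! ### Operations -/

/-- Formal operations of a given sort and dimension with arity a tree: cells of the tree,
composites `y ∘ x` of cells of dimension `p + k + 1` along their `p`-cells, values of
the functors (`fn false` is the domain `F` and `fn true` the codomain `H`), components of the
transformation, and formal liftings of pairs of operations, precomposed with a family of
operations. -/
inductive PreOp : Tree → Side → ℕ → Type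
  | var {T : Tree} {c : Side} {m : ℕ} (x : T.real.cell c m) : PreOp T c m
  | comp {T : Tree} {c : Side} (p k : ℕ) (y x : PreOp T c (p + k + 1)) : PreOp T c (p + k + 1)
  | fn {T : Tree} {m : ℕ} (δ : Bool) (x : PreOp T .X m) : PreOp T .Z m
  | nat {T : Tree} (x : PreOp T .X 0) : PreOp T .Z 1
  | lift {T : Tree} {c : Side} {m : ℕ} (S : Tree) (f g : PreOp S c m)
      (ρ : ∀ (d : Side) (j : ℕ), S.real.cell d j → PreOp T d j) : PreOp T c (m + 1)

namespace PreOp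

/-- Substitution of operations for the cells of the arity. -/
def subst {S T : Tree} (σ : ∀ (d : Side) (j : ℕ), S.real.cell d j → PreOp T d j) :
    ∀ {c : Side} {m : ℕ}, PreOp S c m → PreOp T c m
  | _, _, .var x => σ _ _ x
  | _, _, .comp p k y x => .comp p k (y.subst σ) (x.subst σ)
  | _, _, .fn δ x => .fn δ (x.subst σ)
  | _, _, .nat x => .nat (x.subst σ)
  | _, _, .lift R f g ρ => .lift R f g (fun d j z => (ρ d j z).subst σ)

/-- Auxiliary form of `bd`, which lowers the dimension where this is possible. -/
def pred (ε : Bool) {T : Tree} : ∀ {c : Side} {m : ℕ}, PreOp T c m → PreOp T c (m - 1)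
  | _, 0, .var x => .var x
  | _, _ + 1, .var x => .var (T.real.bd ε x)
  | _, _, .comp _ 0 y x => bif ε then y.pred ε else x.pred ε
  | _, _, .comp p (k + 1) y x => .comp p k (y.pred ε) (x.pred ε)
  | _, _, .fn δ x => .fn δ (x.pred ε)
  | _, _, .nat x => .fn ε x
  | _, _, .lift _ f g ρ => (bif ε then g else f).subst ρ

/-- Source (`false`) and target (`true`) of a formal operation. -/
def bd (ε : Bool) {T : Tree} {c : Side} {m : ℕ} (t : PreOp T c (m + 1)) : PreOp T c m :=
  t.pred ε

variable {S T : Tree} {c : Side} {m : ℕ}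

theorem pred_fn (ε δ : Bool) (x : PreOp T .X m) : (fn δ x).pred ε = fn δ (x.pred ε) := by
  cases m <;> rfl

@[simp] theorem bd_var (ε : Bool) (x : T.real.cell c (m + 1)) :
    (var x).bd ε = var (T.real.bd ε x) := rfl

@[simp] theorem bd_comp_zero (ε : Bool) (p : ℕ) (y x : PreOp T c (p + 0 + 1)) :
    (comp p 0 y x).bd ε = bif ε then y.bd ε else x.bd ε := rfl

@[simp] theorem bd_comp_succ (ε : Bool) (p k : ℕ) (y x : PreOp T c (p + (k + 1) + 1)) :
    (comp p (k + 1) y x).bd ε = comp p k (y.bd ε) (x.bd ε) := rfl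

@[simp] theorem bd_fn (ε δ : Bool) (x : PreOp T .X (m + 1)) :
    (fn δ x).bd ε = fn δ (x.bd ε) := rfl

@[simp] theorem bd_nat (ε : Bool) (x : PreOp T .X 0) : (nat x).bd ε = fn ε x := rfl

@[simp] theorem bd_lift (ε : Bool) (f g : PreOp S c m)
    (ρ : ∀ (d : Side) (j : ℕ), S.real.cell d j → PreOp T d j) :
    (lift S f g ρ).bd ε = (bif ε then g else f).subst ρ := rfl

theorem subst_var (t : PreOp T c m) : t.subst (fun _ _ z => var z) = t := by
  induction t with
  | var x => rfl
  | comp p k y x hy hx => simp only [subst, hy, hx]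
  | fn δ x hx => simp only [subst, hx]
  | nat x hx => simp only [subst, hx]
  | lift R f g ρ hf hg hρ => simp only [subst, hρ]

theorem subst_subst {R : Tree} (σ : ∀ (d : Side) (j : ℕ), R.real.cell d j → PreOp S d j)
    (ρ : ∀ (d : Side) (j : ℕ), S.real.cell d j → PreOp T d j) (t : PreOp R c m) :
    (t.subst σ).subst ρ = t.subst (fun d j z => (σ d j z).subst ρ) := by
  induction t with
  | var x => rfl
  | comp p k y x hy hx => simp only [subst, hy, hx]
  | fn δ x hx => simp only [subst, hx]
  | nat x hx => simp only [subst, hx]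
  | lift R f g ρ hf hg hρ => simp only [subst, hρ]

theorem pred_subst (ε : Bool) {R : Tree} {σ : ∀ (d : Side) (j : ℕ), R.real.cell d j → PreOp T d j}
    (hσ : ∀ (d : Side) (j : ℕ) (z : R.real.cell d (j + 1)),
      (σ d (j + 1) z).bd ε = σ d j (R.real.bd ε z)) (t : PreOp R c m) (hm : m ≠ 0) :
    (t.subst σ).pred ε = (t.pred ε).subst σ := by
  induction t with
  | @var _ _ m x =>
    cases m with
    | zero => exact absurd rfl hm
    | succ m => exact hσ _ _ _
  | comp p k y x hy hx =>
    cases k with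
    | zero => cases ε; exacts [hx hσ hm, hy hσ hm]
    | succ k => exact congrArg₂ (comp p k) (hy hσ hm) (hx hσ hm)
  | fn δ x hx => rw [subst, pred_fn, hx hσ hm, pred_fn, subst]
  | nat x hx => rfl
  | lift R f g ρ hf hg hρ => exact (subst_subst ρ σ _).symm

theorem bd_subst (ε : Bool) (σ : ∀ (d : Side) (j : ℕ), S.real.cell d j → PreOp T d j)
    (hσ : ∀ (d : Side) (j : ℕ) (z : S.real.cell d (j + 1)),
      (σ d (j + 1) z).bd ε = σ d j (S.real.bd ε z)) (t : PreOp S c (m + 1)) :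
    (t.subst σ).bd ε = (t.bd ε).subst σ :=
  pred_subst ε hσ t (Nat.succ_ne_zero m)

/-- Iterated source and target. -/
def bdIter (ε : Bool) {p : ℕ} : ∀ k, PreOp T c (p + k) → PreOp T c p
  | 0, t => t
  | k + 1, t => bdIter ε k (t.bd ε)

/-- Two operations of the same sort and dimension are parallel if they have the same source and
the same target; in dimension `0` there is no condition. -/
def Parallel : ∀ {m : ℕ}, PreOp T c m → PreOp T c m → Prop
  | 0, _, _ => True
  | _ + 1, f, g => ∀ ε, f.bd ε = g.bd ε

/-- The operations that are not algebraic: as morphisms out of a globe they come from morphisms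
of trees. -/
def IsVar (t : PreOp T c m) : Prop := ∃ x, t = var x

/-- `IsOp n t`: the formal operation `t` is an operation of the `n`-th theory of the
Batanin-Grothendieck sequence of the theory of `(2, ∞)`-magmas. For `n = 0`, these are
the elements of the free `(2, ∞)`-magma on a tree: the cells are closed under the
compositions of composable pairs, the two functors and the transformation. For `n + 1`
there is in addition a formal lifting of each admissible pair of operations of the
`n`-th theory, that is, of each pair of parallel algebraic operations. -/
inductive IsOp : ℕ → ∀ {T : Tree} {c : Side} {m : ℕ}, PreOp T c m → Prop
  | var {n : ℕ} {T : Tree} {c : Side} {m : ℕ} (x : T.real.cell c m) : IsOp n (var x)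
  | comp {n : ℕ} {T : Tree} {c : Side} {p k : ℕ} {y x : PreOp T c (p + k + 1)} :
      IsOp n y → IsOp n x → y.bdIter false (k + 1) = x.bdIter true (k + 1) → IsOp n (comp p k y x)
  | fn {n : ℕ} {T : Tree} {m : ℕ} {x : PreOp T .X m} (δ : Bool) : IsOp n x → IsOp n (fn δ x)
  | nat {n : ℕ} {T : Tree} {x : PreOp T .X 0} : IsOp n x → IsOp n (nat x)
  | lift {n : ℕ} {S T : Tree} {c : Side} {m : ℕ} {f g : PreOp S c m}
      {ρ : ∀ (d : Side) (j : ℕ), S.real.cell d j → PreOp T d j} :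
      IsOp n f → IsOp n g → Parallel f g → ¬ f.IsVar → ¬ g.IsVar →
      (∀ d j z, IsOp (n + 1) (ρ d j z)) →
      (∀ ε d j z, (ρ d (j + 1) z).bd ε = ρ d j (S.real.bd ε z)) → IsOp (n + 1) (lift S f g ρ)

theorem IsOp.succ {n : ℕ} {t : PreOp T c m} (h : IsOp n t) : IsOp (n + 1) t := by
  induction h with
  | var x => exact .var x
  | comp _ _ h hy hx => exact .comp hy hx h
  | fn δ _ hx => exact .fn δ hx
  | nat _ hx => exact .nat hx
  | lift _ _ hp hf hg _ hρ ihf ihg ih => exact .lift ihf ihg hp hf hg ih hρ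

theorem IsOp.mono {n n' : ℕ} (hn : n ≤ n') {t : PreOp T c m} (h : IsOp n t) : IsOp n' t := by
  induction hn with
  | refl => exact h
  | step _ ih => exact ih.succ

theorem bdIter_subst (ε : Bool) (σ : ∀ (d : Side) (j : ℕ), S.real.cell d j → PreOp T d j)
    (hσ : ∀ (d : Side) (j : ℕ) (z : S.real.cell d (j + 1)),
      (σ d (j + 1) z).bd ε = σ d j (S.real.bd ε z)) {p : ℕ} (k : ℕ) (t : PreOp S c (p + k)) :
    (t.subst σ).bdIter ε k = (t.bdIter ε k).subst σ := by
  induction k with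
  | zero => rfl
  | succ k ih =>
    change bdIter ε k (bd ε (subst σ t)) = _
    rw [bd_subst ε σ hσ]
    exact ih _

theorem IsOp.subst {n : ℕ} {t : PreOp S c m} (h : IsOp n t)
    (σ : ∀ (d : Side) (j : ℕ), S.real.cell d j → PreOp T d j) (hn : ∀ d j z, IsOp n (σ d j z))
    (hσ : ∀ ε d j z, (σ d (j + 1) z).bd ε = σ d j (S.real.bd ε z)) : IsOp n (t.subst σ) := by
  induction h with
  | var x => exact hn _ _ _
  | comp _ _ h hy hx =>
    refine .comp (hy σ hn hσ) (hx σ hn hσ) ?_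
    exact (bdIter_subst false σ (hσ false) (_ + 1) _).trans
      ((congrArg (PreOp.subst σ) h).trans (bdIter_subst true σ (hσ true) (_ + 1) _).symm)
  | fn δ _ hx => exact .fn δ (hx σ hn hσ)
  | nat _ hx => exact .nat (hx σ hn hσ)
  | lift hf' hg' hp hf hg _ hρ ihf ihg ih =>
    exact .lift hf' hg' hp hf hg (fun d j z => ih d j z σ hn hσ)
      (fun ε d j z => (bd_subst ε σ (hσ ε) _).trans (congrArg _ (hρ ε d j z)))

theorem IsOp.globular {n : ℕ} {t : PreOp T c m} (h : IsOp n t) (hm : 2 ≤ m) (ε δ δ' : Bool) :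
    (t.pred δ).pred ε = (t.pred δ').pred ε := by
  induction h generalizing ε δ δ' with
  | @var _ _ _ m x =>
    obtain ⟨m, rfl⟩ := Nat.exists_eq_add_of_le' hm
    exact congrArg PreOp.var (PairGlob.globular _ ε δ δ' x)
  | @comp n T c p k y x _ _ h hy hx =>
    rcases k with _ | _ | k
    · obtain ⟨p, rfl⟩ : ∃ q, p = q + 1 := ⟨p - 1, by omega⟩
      have h' : y.pred false = x.pred true := h
      have hyx : (y.pred true).pred ε = (x.pred false).pred ε := by
        rw [hy hm ε true false, h']
        exact hx hm ε true false
      cases δ <;> cases δ'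
      exacts [rfl, hyx.symm, hyx, rfl]
    · cases ε
      exacts [hx hm _ _ _, hy hm _ _ _]
    · exact congrArg₂ (PreOp.comp p k) (hy hm _ _ _) (hx hm _ _ _)
  | fn δ _ hx => rw [pred_fn, pred_fn, hx hm, pred_fn, pred_fn]
  | nat _ hx => omega
  | @lift n S T c m f g ρ _ _ hp _ _ _ hρ _ _ _ =>
    obtain ⟨m, rfl⟩ : ∃ q, m = q + 1 := ⟨m - 1, by omega⟩
    have : f.bd ε = g.bd ε := hp ε
    have e (t : PreOp S c (m + 1)) : (t.subst ρ).bd ε = (t.bd ε).subst ρ := bd_subst ε ρ (hρ ε) t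
    have e' : (f.subst ρ).bd ε = (g.subst ρ).bd ε := by rw [e, e, this]
    cases δ <;> cases δ'
    exacts [rfl, e', e'.symm, rfl]

theorem IsOp.bd_bd {n : ℕ} {t : PreOp T c (m + 2)} (h : IsOp n t) (ε δ δ' : Bool) :
    (t.bd δ).bd ε = (t.bd δ').bd ε := h.globular (Nat.le_add_left 2 m) ε δ δ'

theorem IsOp.bdIter_bd {n p k : ℕ} {t : PreOp T c (p + (k + 1) + 1)} (h : IsOp n t)
    (ε δ δ' : Bool) : (t.bd δ).bdIter ε (k + 1) = (t.bd δ').bdIter ε (k + 1) :=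
  congrArg (PreOp.bdIter ε k) (h.bd_bd ε δ δ')

theorem IsOp.pred {n : ℕ} {t : PreOp T c m} (h : IsOp n t) (ε : Bool) : IsOp n (t.pred ε) := by
  induction h with
  | @var _ _ _ m x => cases m <;> exact .var _
  | @comp n T c p k y x hy' hx' h hy hx =>
    cases k with
    | zero => cases ε; exacts [hx, hy]
    | succ k =>
      exact .comp hy hx ((hy'.bdIter_bd false ε false).trans (Eq.trans h (hx'.bdIter_bd true true ε)))
  | fn δ _ hx => rw [pred_fn]; exact .fn _ hx
  | nat hx' _ => exact .fn ε hx'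
  | lift hf hg _ _ _ hn hρ _ _ _ =>
    cases ε
    exacts [hf.succ.subst _ hn hρ, hg.succ.subst _ hn hρ]

theorem IsOp.bd {n : ℕ} {t : PreOp T c (m + 1)} (h : IsOp n t) (ε : Bool) : IsOp n (t.bd ε) :=
  h.pred ε

end PreOp

open PreOp (IsOp)

/-- The pair of globular sets of operations of arity `T` in the `n`-th theory. In particular
`ops 0 T` is the free `(2, ∞)`-magma on `T`. -/
def ops (n : ℕ) (T : Tree) : PairGlob where
  cell c m := {t : PreOp T c m // IsOp n t}
  bd ε _ _ t := ⟨t.1.bd ε, t.2.bd ε⟩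
  globular ε δ δ' _ _ t := Subtype.ext (t.2.bd_bd ε δ δ')

/-! ### The coherator -/

/-- The objects of the coherator are the trees. -/
structure Coh where
  tree : Tree

/-- The morphisms `S ⟶ T` of the coherator are the maps of pairs of globular sets from the globular
sum of `S` to the operations of arity `T` in one of the theories of the Batanin-Grothendieck
sequence: this is the colimit of the sequence of theories. Those with `n = 0` are the morphisms
of the Kleisli category of the monad of `(2, ∞)`-magmas. -/
@[ext]
structure Coh.Hom (S T : Coh) where
  app : ∀ (d : Side) (j : ℕ), S.tree.real.cell d j → PreOp T.tree d j
  comm : ∀ ε d j z, (app d (j + 1) z).bd ε = app d j (S.tree.real.bd ε z)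
  isOp : ∃ n, ∀ d j z, IsOp n (app d j z)

instance : Category Coh where
  Hom := Coh.Hom
  id S :=
    { app := fun _ _ z => .var z
      comm := fun _ _ _ _ => rfl
      isOp := ⟨0, fun _ _ z => .var z⟩ }
  comp {R S T} φ ψ :=
    { app := fun d j z => (φ.app d j z).subst ψ.app
      comm := fun ε d j z => by rw [PreOp.bd_subst ε _ (ψ.comm ε), φ.comm]
      isOp := by
        obtain ⟨n, hn⟩ := φ.isOp
        obtain ⟨n', hn'⟩ := ψ.isOp
        exact ⟨max n n', fun d j z => ((hn d j z).mono (le_max_left _ _)).subst _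
          (fun d j z => (hn' d j z).mono (le_max_right _ _)) ψ.comm⟩ }
  id_comp _ := rfl
  comp_id φ := Coh.Hom.ext (by funext d j z; exact PreOp.subst_var _)
  assoc φ ψ χ := Coh.Hom.ext (by funext d j z; exact PreOp.subst_subst _ _ _)

/-- The inclusion of maps of trees in the coherator. -/
def Coh.ofMap {S T : Tree} (φ : S.real.Hom T.real) : Coh.mk S ⟶ Coh.mk T where
  app _ _ z := .var (φ.app z)
  comm ε _ _ z := congrArg PreOp.var (φ.comm ε z)
  isOp := ⟨0, fun _ _ _ => .var _⟩

/-- A cell of a pair of globular sets restricted to the cells of the globe. -/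
def PairGlob.face (A : PairGlob) {c : Side} : ∀ {m : ℕ}, A.cell c m → ∀ {j : ℕ},
    GlobeCell m j → A.cell c j
  | _, x, _, .top h => h ▸ x
  | 0, _, _, .bdry h _ => absurd h (Nat.not_lt_zero _)
  | m + 1, x, j, .bdry h ε =>
    if e : j = m then e ▸ A.bd ε x
    else A.face (A.bd ε x) (.bdry (lt_of_le_of_ne (Nat.le_of_lt_succ h) e) ε)

theorem PairGlob.face_last (A : PairGlob) {c : Side} {m : ℕ} (x : A.cell c (m + 1)) (ε : Bool)
    (h : m < m + 1) : A.face x (.bdry h ε) = A.bd ε x := by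
  simp [PairGlob.face]

theorem PairGlob.face_bdry (A : PairGlob) {c : Side} {m j : ℕ} (x : A.cell c (m + 1)) (ε δ : Bool)
    (h : j < m + 1) (h' : j < m) : A.face x (.bdry h ε) = A.face (A.bd δ x) (.bdry h' ε) := by
  rw [PairGlob.face, dif_neg h'.ne]
  obtain ⟨m, rfl⟩ := Nat.exists_eq_succ_of_ne_zero (Nat.ne_zero_of_lt h')
  rw [PairGlob.face, PairGlob.face]
  split_ifs with e
  · subst e; exact A.globular _ _ _ _
  · rw [A.globular ε ε δ x]

theorem PairGlob.bd_face (A : PairGlob) {c : Side} (ε : Bool) {m : ℕ} (x : A.cell c m) {j : ℕ}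
    (z : GlobeCell m (j + 1)) : A.bd ε (A.face x z) = A.face x (z.bd ε) := by
  rcases z with e | ⟨h, δ⟩
  · subst e
    rw [PairGlob.face, GlobeCell.bd, A.face_last]
  · induction m with
    | zero => exact absurd h (Nat.not_lt_zero _)
    | succ m ih =>
      by_cases e : j + 1 = m
      · subst e
        rw [A.face_last, GlobeCell.bd, A.face_bdry x ε δ _ (Nat.lt_succ_self j), A.face_last]
      · have h' : j + 1 < m := lt_of_le_of_ne (Nat.le_of_lt_succ h) e
        rw [A.face_bdry x δ δ h h', ih, GlobeCell.bd, GlobeCell.bd,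
          A.face_bdry x ε δ _ (Nat.lt_of_succ_lt h')]

theorem PairGlob.face_face (A : PairGlob) {c : Side} {m p j : ℕ} (x : A.cell c m) (h : p < m)
    (ε δ : Bool) (h' : j < p) :
    A.face (A.face x (.bdry h ε)) (.bdry h' δ) = A.face x (.bdry (h'.trans h) δ) := by
  induction m with
  | zero => exact absurd h (Nat.not_lt_zero _)
  | succ m ih =>
    by_cases e : p = m
    · subst e
      rw [A.face_last, ← A.face_bdry]
    · have hp : p < m := lt_of_le_of_ne (Nat.le_of_lt_succ h) e
      rw [A.face_bdry x ε false h hp, ih, ← A.face_bdry]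

/-- The Yoneda lemma for globes. -/
def PairGlob.yoneda (A : PairGlob) {a : GObj} (x : A.cell a.side a.arityDim) : a.D.Hom A where
  app z := z.2 ▸ A.face x z.1
  comm ε c m z := by
    obtain ⟨z, rfl⟩ := z
    exact A.bd_face ε x z

/-- The map out of the one-entry tree of a globe given by a cell. -/
def Tree.globeMap {A : PairGlob} {c : Side} {m : ℕ} (x : A.cell c m) :
    (Tree.single (.glob c m)).real.Hom A :=
  (Tree.single (.glob c m)).desc (fun _ => PairGlob.yoneda (a := .glob c m) A x)
    (fun l => l.elim0)

theorem Tree.globeMap_gen {A : PairGlob} {c : Side} {m : ℕ} (x : A.cell c m) :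
    (Tree.globeMap x).app ((Tree.single (.glob c m)).gen 0) = x := by
  change A.face x (.top rfl) = x
  rw [PairGlob.face]

namespace Coh

/-- The globe `1(m)` or `2(m)` as an object of the coherator. -/
def globe (c : Side) (m : ℕ) : Coh := ⟨.single (.glob c m)⟩

/-- The morphism out of a globe given by an operation: the morphisms `globe c m ⟶ T` are the
`m`-operations of arity `T`. -/
noncomputable def opHom {T : Tree} {c : Side} {m : ℕ} (t : PreOp T c m) (ht : ∃ n, IsOp n t) :
    globe c m ⟶ ⟨T⟩ where
  app _ _ z := ((Tree.globeMap (A := ops ht.choose T) ⟨t, ht.choose_spec⟩).app z).1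
  comm ε _ _ z := congrArg Subtype.val
    ((Tree.globeMap (A := ops ht.choose T) ⟨t, ht.choose_spec⟩).comm ε z)
  isOp := ⟨ht.choose, fun _ _ _ => Subtype.prop _⟩

/-- The operation given by a morphism out of a globe. -/
def toOp {T : Tree} {c : Side} {m : ℕ} (φ : globe c m ⟶ ⟨T⟩) : PreOp T c m :=
  Hom.app φ c m ((Tree.single (.glob c m)).gen 0)

theorem toOp_isOp {T : Tree} {c : Side} {m : ℕ} (φ : globe c m ⟶ ⟨T⟩) : ∃ n, IsOp n (toOp φ) :=
  φ.isOp.imp fun _ h => h _ _ _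

@[simp] theorem toOp_opHom {T : Tree} {c : Side} {m : ℕ} (t : PreOp T c m) (ht : ∃ n, IsOp n t) :
    toOp (opHom t ht) = t := by
  exact congrArg Subtype.val
    (Tree.globeMap_gen (A := ops ht.choose T) ⟨t, ht.choose_spec⟩)

theorem hom_ext {T : Tree} {c : Side} {m : ℕ} {φ ψ : globe c m ⟶ ⟨T⟩} (h : toOp φ = toOp ψ) :
    φ = ψ := by
  have key : ∀ (d j : ℕ) (e : j + d = m) (z : GlobeCell m j),
      Hom.app φ c j (((Tree.single (.glob c m)).incl 0).app ⟨z, rfl⟩) =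
        Hom.app ψ c j (((Tree.single (.glob c m)).incl 0).app ⟨z, rfl⟩) := by
    intro d
    induction d with
    | zero =>
      intro j e z
      rcases z with h' | ⟨h', _⟩
      · obtain rfl : j = m := h'
        exact h
      · omega
    | succ d ih =>
      intro j e z
      rcases z with h' | ⟨h', ε⟩
      · omega
      · let z' : GlobeCell m (j + 1) :=
          if h : j + 1 = m then .top h else .bdry (lt_of_le_of_ne h' h) false
        exact (Hom.comm φ ε c j _).symm.trans
          ((congrArg (PreOp.bd ε) (ih (j + 1) (by omega) z')).trans (Hom.comm ψ ε c j _))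
  apply Hom.ext
  funext d j z
  obtain ⟨⟨l, z⟩, rfl⟩ := Quot.exists_rep z
  obtain ⟨z, hz⟩ := z
  obtain rfl : l = 0 := Subsingleton.elim (α := Fin 1) _ _
  obtain rfl : c = d := hz
  exact key (m - j) j (Nat.add_sub_of_le z.le) z

/-- The coprojections of a globular sum, in the coherator. -/
def incl (T : Tree) (l : Fin (T.len + 1)) : mk (.single (T.top l)) ⟶ mk T :=
  ofMap ((Tree.single (T.top l)).desc (fun _ => T.incl l) (fun l => l.elim0))

/-- The image in the coherator of an arrow of the 2-globe category. -/
def leg {ε : Bool} {a b : GObj} (h : a.Leg ε b) : mk (.single a) ⟶ mk (.single b) :=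
  ofMap ((Tree.single a).desc (fun _ => h.map.comp ((Tree.single b).incl 0)) (fun l => l.elim0))

/-- The cosource (`false`) and cotarget (`true`) maps of globes. -/
def legHom (ε : Bool) (c : Side) {p n : ℕ} (h : p ≤ n) : globe c p ⟶ globe c n :=
  leg (.glob ε c h)

end Coh

/-- `h` is a lifting of the couple `(f, g)` of operations, which is admissible: `f` and `g` are
parallel and algebraic. -/
structure PreOp.IsLifting {T : Tree} {c : Side} {m : ℕ} (f g : PreOp T c m)
    (h : PreOp T c (m + 1)) : Prop where
  left : ∃ n, IsOp n f
  right : ∃ n, IsOp n g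
  parallel : f.Parallel g
  left_algebraic : ¬ f.IsVar
  right_algebraic : ¬ g.IsVar
  isOp : ∃ n, IsOp n h
  src : h.bd false = f
  tgt : h.bd true = g

/-! ### Models -/

/-- The `Sets`-models of the coherator, that is, the globular weak `(2, ∞)`-transformations:
the functors to sets that send globular sums to globular products. -/
structure Model where
  functor : Cohᵒᵖ ⥤ Type u
  segal : ∀ (T : Tree) (x : ∀ l, functor.obj (op (Coh.mk (.single (T.top l))))),
    (∀ l : Fin T.len, functor.map (Coh.leg (T.tleg l)).op (x l.castSucc) =
      functor.map (Coh.leg (T.sleg l)).op (x l.succ)) →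
    ∃! w : functor.obj (op (Coh.mk T)), ∀ l, functor.map (Coh.incl T l).op w = x l

namespace Model

variable (τ : Model.{u})

/-- The `m`-cells of the domain `X` and of the codomain `Z`. -/
def cell (c : Side) (m : ℕ) : Type u := τ.functor.obj (op (Coh.globe c m))

/-- The value of an operation of arity `T` at a family of cells of shape `T`. -/
noncomputable def eval {T : Tree} {c : Side} {m : ℕ} (t : PreOp T c m) (ht : ∃ n, IsOp n t)
    (w : τ.functor.obj (op (Coh.mk T))) : τ.cell c m :=
  τ.functor.map (Coh.opHom t ht).op w

/-- The iterated source (`false`) and target (`true`) of a cell. -/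
def bdTo (ε : Bool) {c : Side} {p n : ℕ} (h : p ≤ n) (x : τ.cell c n) : τ.cell c p :=
  τ.functor.map (Coh.legHom ε c h).op x

/-- The source (`false`) and target (`true`) of a cell. -/
def bd (ε : Bool) {c : Side} {m : ℕ} (x : τ.cell c (m + 1)) : τ.cell c m :=
  τ.bdTo ε (Nat.le_succ m) x

variable {τ}

theorem map_comp_apply {R S T : Coh} (φ : R ⟶ S) (ψ : S ⟶ T) (w : τ.functor.obj (op T)) :
    τ.functor.map φ.op (τ.functor.map ψ.op w) = τ.functor.map (φ ≫ ψ).op w := by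
  rw [op_comp, Functor.map_comp]
  rfl

theorem map_eq_eval {T : Tree} {c : Side} {m : ℕ} (φ : Coh.globe c m ⟶ Coh.mk T)
    {t : PreOp T c m} (ht : ∃ n, IsOp n t) (h : Coh.toOp φ = t)
    (w : τ.functor.obj (op (Coh.mk T))) : τ.functor.map φ.op w = τ.eval t ht w := by
  have : φ = Coh.opHom t ht := Coh.hom_ext (by rw [h, Coh.toOp_opHom])
  rw [this]
  rfl

theorem bd_eval (ε : Bool) {T : Tree} {c : Side} {m : ℕ} (t : PreOp T c (m + 1))
    (ht : ∃ n, IsOp n t) (w : τ.functor.obj (op (Coh.mk T))) :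
    τ.bd ε (τ.eval t ht w) = τ.eval (t.bd ε) (ht.imp fun _ h => h.bd ε) w := by
  refine (map_comp_apply _ _ w).trans (map_eq_eval _ _ ?_ w)
  have h : (GObj.Leg.glob ε c (Nat.le_succ m)).map.app ⟨.top rfl, rfl⟩ =
      (GObj.glob c (m + 1)).D.bd ε ⟨.top rfl, rfl⟩ := by
    refine Subtype.ext ?_
    exact dif_neg (Nat.lt_succ_self m).ne
  have h' : Coh.toOp (Coh.legHom ε c (Nat.le_succ m) ≫ Coh.opHom t ht) =
      (Coh.toOp (Coh.opHom t ht)).bd ε := by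
    rw [Coh.toOp, Coh.toOp]
    refine Eq.trans ?_ (Coh.Hom.comm (Coh.opHom t ht) ε c m _).symm
    exact congrArg (fun z => Coh.Hom.app (Coh.opHom t ht) c m
      (((Tree.single (.glob c (m + 1))).incl 0).app z)) h
  rw [h', Coh.toOp_opHom]

theorem bd_bd_eq_bdTo (ε δ : Bool) {c : Side} {m : ℕ} (x : τ.cell c (m + 2)) :
    τ.bd ε (τ.bd δ x) = τ.bdTo ε (Nat.le_add_right m 2) x := by
  refine (map_comp_apply _ _ x).trans ?_
  refine congrArg (fun φ => τ.functor.map (Quiver.Hom.op φ) x) (Coh.hom_ext ?_)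
  have h : GlobeCell.push δ (Nat.le_succ (m + 1))
      (GlobeCell.push ε (Nat.le_succ m) (GlobeCell.top (rfl : m = m))) =
      GlobeCell.push ε (Nat.le_add_right m 2) (.top rfl) := by
    rw [GlobeCell.push_top _ (Nat.lt_succ_self m), GlobeCell.push_top _ (Nat.lt_add_of_pos_right two_pos)]
    rfl
  exact congrArg (fun z => PreOp.var (((Tree.single (.glob c (m + 2))).incl 0).app ⟨z, rfl⟩)) h

end Model

/-! ### Composition -/

/-- The tree of `k + 1` globes of dimension `n`, glued along their `p`-cells. -/
def Tree.chain (c : Side) {p n : ℕ} (h : p ≤ n) (k : ℕ) : Tree where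
  len := k
  top _ := .glob c n
  bot _ := .glob c p
  tleg _ := .glob true c h
  sleg _ := .glob false c h

/-- The coprojections of a chain. -/
def Tree.cincl (c : Side) {p n : ℕ} (h : p ≤ n) {k : ℕ} (l : Fin (k + 1)) :
    (GObj.glob c n).D.Hom (Tree.chain c h k).real :=
  (Tree.chain c h k).incl l

theorem Tree.cincl_glue (c : Side) {p n : ℕ} (h : p ≤ n) {d : Side} {m : ℕ}
    (z : (GObj.glob c p).D.cell d m) :
    (Tree.cincl c h (0 : Fin 2)).app ((GObj.Leg.glob true c h).map.app z) =
      (Tree.cincl c h (1 : Fin 2)).app ((GObj.Leg.glob false c h).map.app z) :=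
  (Tree.chain c h 1).incl_glue (0 : Fin 1) z

/-- A tree with two entries. -/
def Tree.two {a b e : GObj} (ht : GObj.Leg true e a) (hs : GObj.Leg false e b) : Tree where
  len := 1
  top := ![a, b]
  bot _ := e
  tleg := Fin.cases ht (fun l => l.elim0)
  sleg := Fin.cases hs (fun l => l.elim0)

namespace PreOp

/-- The cells of a chain, as operations. -/
def cvar {c : Side} {p n k : ℕ} (h : p ≤ n) (l : Fin (k + 1)) : PreOp (.chain c h k) c n :=
  .var ((Tree.cincl c h l).app ⟨.top rfl, rfl⟩)

theorem bdIter_var {T : Tree} {c : Side} (ε : Bool) {p : ℕ} (k : ℕ) {n : ℕ}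
    (φ : (GObj.glob c n).D.Hom T.real) (z : GlobeCell n (p + k + 1)) (h : p < n) :
    bdIter ε (k + 1) (.var (φ.app ⟨z, rfl⟩) : PreOp T c (p + k + 1)) =
      .var (φ.app ⟨.bdry h ε, rfl⟩) := by
  induction k with
  | zero => exact congrArg var (φ.comm ε _)
  | succ k ih =>
    refine Eq.trans ?_ (ih (z.bd ε))
    exact congrArg (bdIter ε (k + 1)) (congrArg var (φ.comm ε _))

theorem isOp_comp_cvar {c : Side} (p k : ℕ) {h : p ≤ p + k + 1} :
    IsOp 0 (comp p k (cvar (c := c) h (1 : Fin 2)) (cvar h 0)) := by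
  have hlt : p < p + k + 1 := by omega
  refine .comp (.var _) (.var _) ?_
  refine (bdIter_var false k (Tree.cincl c h (1 : Fin 2)) (.top rfl) hlt).trans ?_
  refine Eq.trans ?_ (bdIter_var true k (Tree.cincl c h (0 : Fin 2)) (.top rfl) hlt).symm
  have e (ε : Bool) : (GObj.Leg.glob ε c h).map.app ⟨.top rfl, rfl⟩ = ⟨.bdry hlt ε, rfl⟩ :=
    Subtype.ext (GlobeCell.push_top ε hlt)
  have := Tree.cincl_glue c h ⟨.top rfl, rfl⟩
  rw [e, e] at this
  exact congrArg PreOp.var this.symm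

/-- Composable pairs in an operation. -/
def CompOk (n : ℕ) {T : Tree} {c : Side} {m : ℕ} : PreOp T c m → Prop
  | .comp _ k y x => IsOp n y ∧ IsOp n x ∧ y.bdIter false (k + 1) = x.bdIter true (k + 1)
  | _ => True

theorem IsOp.compOk {n : ℕ} {T : Tree} {c : Side} {m : ℕ} {t : PreOp T c m} (h : IsOp n t) :
    t.CompOk n := by
  cases h with
  | comp hy hx e => exact ⟨hy, hx, e⟩
  | _ => trivial

end PreOp

namespace Model

variable (τ : Model.{u})

/-- The element of the model given by a family of composable cells. -/
noncomputable def glue (T : Tree) (x : ∀ l, τ.functor.obj (op (Coh.mk (.single (T.top l)))))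
    (hx : ∀ l : Fin T.len, τ.functor.map (Coh.leg (T.tleg l)).op (x l.castSucc) =
      τ.functor.map (Coh.leg (T.sleg l)).op (x l.succ)) : τ.functor.obj (op (Coh.mk T)) :=
  (τ.segal T x hx).choose

variable {τ} in
theorem map_incl_glue {T : Tree} {x : ∀ l, τ.functor.obj (op (Coh.mk (.single (T.top l))))}
    {hx} (l) : τ.functor.map (Coh.incl T l).op (τ.glue T x hx) = x l :=
  (τ.segal T x hx).choose_spec.1 l

variable {τ} in
theorem eq_glue {T : Tree} {x : ∀ l, τ.functor.obj (op (Coh.mk (.single (T.top l))))}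
    {hx} {w : τ.functor.obj (op (Coh.mk T))} (h : ∀ l, τ.functor.map (Coh.incl T l).op w = x l) :
    w = τ.glue T x hx :=
  (τ.segal T x hx).unique h (τ.segal T x hx).choose_spec.1

/-- The pair of two composable cells, as an element of the model. -/
noncomputable def pair {c : Side} {p n : ℕ} (h : p ≤ n) (y x : τ.cell c n)
    (e : τ.bdTo true h x = τ.bdTo false h y) : τ.functor.obj (op (Coh.mk (.chain c h 1))) :=
  τ.glue (.chain c h 1) (Fin.cases (motive := fun _ : Fin 2 => τ.cell c n) x fun _ => y)
    (Fin.cases (n := 0) e fun l => l.elim0)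

/-- The composite of two cells `x` and `y` along a common `p`-cell. -/
noncomputable def comp {c : Side} (p k : ℕ) (y x : τ.cell c (p + k + 1))
    (e : τ.bdTo true (by omega) x = τ.bdTo false (by omega : p ≤ p + k + 1) y) :
    τ.cell c (p + k + 1) :=
  τ.eval (.comp p k (.cvar (by omega) (1 : Fin 2)) (.cvar (by omega) 0)) ⟨0, PreOp.isOp_comp_cvar p k⟩
    (τ.pair (by omega) y x e)

variable {τ}

theorem ops_face {n : ℕ} {T : Tree} {c : Side} {p k : ℕ} (x : (ops n T).cell c (p + k + 1))
    (ε : Bool) (h : p < p + k + 1) :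
    ((ops n T).face x (.bdry h ε)).1 = x.1.bdIter ε (k + 1) := by
  induction k with
  | zero => rw [PairGlob.face_last]; rfl
  | succ k ih =>
    rw [PairGlob.face_bdry (A := ops n T) (m := p + k + 1) x ε ε h (by omega)]
    exact ih ((ops n T).bd ε x) _

/-- The morphism of the coherator given by two composable operations. -/
theorem exists_pairHom {T : Tree} {c : Side} {p k : ℕ} {y x : PreOp T c (p + k + 1)}
    (h : p ≤ p + k + 1) (ht : ∃ n, IsOp n (.comp p k y x)) :
    ∃ φ : Coh.mk (.chain c h 1) ⟶ Coh.mk T,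
      Coh.Hom.app φ c (p + k + 1) ((Tree.cincl c h (0 : Fin 2)).app ⟨.top rfl, rfl⟩) = x ∧
      Coh.Hom.app φ c (p + k + 1) ((Tree.cincl c h (1 : Fin 2)).app ⟨.top rfl, rfl⟩) = y := by
  obtain ⟨n, hn⟩ := ht
  obtain ⟨hy, hx, e⟩ := PreOp.IsOp.compOk hn
  let A := ops n T
  let x' : A.cell c (p + k + 1) := ⟨x, hx⟩
  let y' : A.cell c (p + k + 1) := ⟨y, hy⟩
  have hlt : p < p + k + 1 := by omega
  have e' : A.face x' (.bdry hlt true) = A.face y' (.bdry hlt false) :=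
    Subtype.ext ((ops_face x' true hlt).trans (e.symm.trans (ops_face y' false hlt).symm))
  have key : ∀ {j : ℕ} (z : GlobeCell p j),
      A.face x' (z.push true h) = A.face y' (z.push false h) := by
    rintro j (rfl | ⟨hj, δ⟩)
    · rw [GlobeCell.push_top _ hlt, GlobeCell.push_top _ hlt, e']
    · change A.face x' (.bdry _ δ) = A.face y' (.bdry _ δ)
      rw [← A.face_face x' hlt true δ hj, ← A.face_face y' hlt false δ hj, e']
  let φ : (Tree.chain c h 1).real.Hom A := (Tree.chain c h 1).desc
    (Fin.cases (PairGlob.yoneda (a := .glob c (p + k + 1)) A x')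
      fun _ => PairGlob.yoneda (a := .glob c (p + k + 1)) A y')
    (Fin.cases (n := 0) (fun {d j} z => by
      obtain ⟨z, hz⟩ := z
      obtain rfl : c = d := hz
      exact key z) fun l => l.elim0)
  refine ⟨⟨fun d j z => (φ.app z).1, fun ε d j z => congrArg Subtype.val (φ.comm ε z),
    n, fun d j z => (φ.app z).2⟩, ?_, ?_⟩
  · change (A.face x' (.top rfl)).1 = x
    rw [PairGlob.face]
  · change (A.face y' (.top rfl)).1 = y
    rw [PairGlob.face]

theorem eval_comp {T : Tree} {c : Side} {p k : ℕ} {y x : PreOp T c (p + k + 1)}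
    (ht : ∃ n, IsOp n (.comp p k y x)) (hy : ∃ n, IsOp n y) (hx : ∃ n, IsOp n x)
    (w : τ.functor.obj (op (Coh.mk T))) (e) :
    τ.eval (.comp p k y x) ht w = τ.comp p k (τ.eval y hy w) (τ.eval x hx w) e := by
  have h : p ≤ p + k + 1 := by omega
  obtain ⟨φ, h0, h1⟩ := exists_pairHom h ht
  have key : τ.functor.map φ.op w = τ.pair h (τ.eval y hy w) (τ.eval x hx w) e := by
    refine eq_glue fun l => (map_comp_apply _ _ w).trans ?_
    match l with
    | ⟨0, _⟩ => exact map_eq_eval (Coh.incl (.chain c h 1) (0 : Fin 2) ≫ φ) hx h0 w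
    | ⟨1, _⟩ => exact map_eq_eval (Coh.incl (.chain c h 1) (1 : Fin 2) ≫ φ) hy h1 w
  rw [comp, ← key]
  refine ((map_comp_apply _ _ w).trans (map_eq_eval _ ht ?_ w)).symm
  rw [← h0, ← h1]
  exact congrArg (PreOp.subst (Coh.Hom.app φ)) (Coh.toOp_opHom _ _)

theorem eval_pair_one {c : Side} {p n : ℕ} (h : p ≤ n) {y x : τ.cell c n} {e} {ht} :
    τ.eval (.cvar h (1 : Fin 2)) ht (τ.pair h y x e) = y :=
  (map_eq_eval (Coh.incl (.chain c h 1) (1 : Fin 2)) ht rfl _).symm.trans (map_incl_glue _)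

theorem eval_pair_zero {c : Side} {p n : ℕ} (h : p ≤ n) {y x : τ.cell c n} {e} {ht} :
    τ.eval (.cvar h (0 : Fin 2)) ht (τ.pair h y x e) = x :=
  (map_eq_eval (Coh.incl (.chain c h 1) (0 : Fin 2)) ht rfl _).symm.trans (map_incl_glue _)

theorem eval_congr {T : Tree} {c : Side} {m : ℕ} {t t' : PreOp T c m} (h : t = t')
    {ht : ∃ n, IsOp n t} {ht' : ∃ n, IsOp n t'} {w : τ.functor.obj (op (Coh.mk T))} :
    τ.eval t ht w = τ.eval t' ht' w := by
  subst h; rfl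

theorem comp_congr {c : Side} {p k : ℕ} {y x y' x' : τ.cell c (p + k + 1)} {e e'}
    (hy : y = y') (hx : x = x') : τ.comp p k y x e = τ.comp p k y' x' e' := by
  subst hy hx; rfl

theorem bd_comp_zero (ε : Bool) {c : Side} {p : ℕ} (y x : τ.cell c (p + 0 + 1)) (e) :
    τ.bd ε (τ.comp p 0 y x e) = bif ε then τ.bd ε y else τ.bd ε x := by
  have h : p ≤ p + 0 + 1 := by omega
  have hy : τ.bd ε (τ.eval _ ⟨0, .var _⟩ (τ.pair h y x e)) = τ.bd ε y :=
    congrArg (τ.bd ε) (eval_pair_one h)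
  have hx : τ.bd ε (τ.eval _ ⟨0, .var _⟩ (τ.pair h y x e)) = τ.bd ε x :=
    congrArg (τ.bd ε) (eval_pair_zero h)
  rw [bd_eval] at hy hx
  rw [comp, bd_eval]
  cases ε
  · exact hx
  · exact hy

theorem bd_comp_succ (ε : Bool) {c : Side} {p k : ℕ} (y x : τ.cell c (p + (k + 1) + 1)) (e) (e') :
    τ.bd ε (τ.comp p (k + 1) y x e) = τ.comp p k (τ.bd ε y) (τ.bd ε x) e' := by
  have h : p ≤ p + (k + 1) + 1 := by omega
  have hy : τ.bd ε (τ.eval _ ⟨0, .var _⟩ (τ.pair h y x e)) = τ.bd ε y :=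
    congrArg (τ.bd ε) (eval_pair_one h)
  have hx : τ.bd ε (τ.eval _ ⟨0, .var _⟩ (τ.pair h y x e)) = τ.bd ε x :=
    congrArg (τ.bd ε) (eval_pair_zero h)
  rw [bd_eval] at hy hx
  rw [comp, bd_eval]
  refine (eval_comp _ ⟨0, IsOp.bd (.var _) _⟩ ⟨0, IsOp.bd (.var _) _⟩ _ ?_).trans
    (comp_congr hy hx)
  rw [hy, hx]
  exact e'

end Model

namespace PreOp

/-- The generic cell of a globe, as an operation. -/
def gvar (c : Side) (n : ℕ) : PreOp (.single (.glob c n)) c n :=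
  .var ((Tree.single (.glob c n)).gen 0)

end PreOp

namespace Model

variable (τ : Model.{u})

/-- The maps from the cells of `X` to the cells of `Z` given by the domain `F` (`δ = false`) and
the codomain `H` (`δ = true`) of a transformation. -/
noncomputable def fn (δ : Bool) {m : ℕ} (x : τ.cell .X m) : τ.cell .Z m :=
  τ.eval (.fn δ (.gvar .X m)) ⟨0, .fn δ (.var _)⟩ x

/-- The components of a transformation. -/
noncomputable def nat (x : τ.cell .X 0) : τ.cell .Z 1 :=
  τ.eval (.nat (.gvar .X 0)) ⟨0, .nat (.var _)⟩ x

variable {τ}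

theorem eval_gvar {c : Side} {m : ℕ} {ht} (x : τ.cell c m) : τ.eval (.gvar c m) ht x = x :=
  have h : τ.functor.map (𝟙 (op (Coh.globe c m))) x = x :=
    congrArg (fun φ : τ.functor.obj (op (Coh.globe c m)) ⟶ _ => φ x)
      (τ.functor.map_id (op (Coh.globe c m)))
  (map_eq_eval (𝟙 (Coh.globe c m)) ht rfl x).symm.trans h

theorem eval_fn {T : Tree} {δ : Bool} {m : ℕ} {t : PreOp T .X m} (h : ∃ n, IsOp n (.fn δ t))
    (ht : ∃ n, IsOp n t) (w : τ.functor.obj (op (Coh.mk T))) :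
    τ.eval (.fn δ t) h w = τ.fn δ (τ.eval t ht w) := by
  refine ((map_comp_apply _ _ w).trans (map_eq_eval _ h ?_ w)).symm
  refine (congrArg (PreOp.subst (Coh.Hom.app (Coh.opHom t ht))) (Coh.toOp_opHom _ _)).trans ?_
  exact congrArg (PreOp.fn δ) (Coh.toOp_opHom t ht)

theorem eval_nat {T : Tree} {t : PreOp T .X 0} (h : ∃ n, IsOp n (.nat t))
    (ht : ∃ n, IsOp n t) (w : τ.functor.obj (op (Coh.mk T))) :
    τ.eval (.nat t) h w = τ.nat (τ.eval t ht w) := by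
  refine ((map_comp_apply _ _ w).trans (map_eq_eval _ h ?_ w)).symm
  refine (congrArg (PreOp.subst (Coh.Hom.app (Coh.opHom t ht))) (Coh.toOp_opHom _ _)).trans ?_
  exact congrArg PreOp.nat (Coh.toOp_opHom t ht)

theorem bd_fn (ε δ : Bool) {m : ℕ} (x : τ.cell .X (m + 1)) :
    τ.bd ε (τ.fn δ x) = τ.fn δ (τ.bd ε x) := by
  refine (bd_eval _ _ _ _).trans ((eval_fn _ ⟨0, .var _⟩ x).trans (congrArg (τ.fn δ) ?_))
  refine (bd_eval ε (.gvar .X (m + 1)) ⟨0, .var _⟩ x).symm.trans ?_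
  rw [eval_gvar]

theorem bd_nat (ε : Bool) (x : τ.cell .X 0) : τ.bd ε (τ.nat x) = τ.fn ε x :=
  bd_eval _ _ _ _

theorem bd_src_eval {T : Tree} {c : Side} {m : ℕ} {f g : PreOp T c m} {t : PreOp T c (m + 1)}
    (h : PreOp.IsLifting f g t) (w : τ.functor.obj (op (Coh.mk T))) :
    τ.bd false (τ.eval t h.isOp w) = τ.eval f h.left w :=
  (bd_eval _ _ _ _).trans (eval_congr h.src)

theorem bd_tgt_eval {T : Tree} {c : Side} {m : ℕ} {f g : PreOp T c m} {t : PreOp T c (m + 1)}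
    (h : PreOp.IsLifting f g t) (w : τ.functor.obj (op (Coh.mk T))) :
    τ.bd true (τ.eval t h.isOp w) = τ.eval g h.right w :=
  (bd_eval _ _ _ _).trans (eval_congr h.tgt)

/-- The model has dimension `p`: for `q > p`, it equalizes the source and the target of all
`q`-operations. -/
def HasDim (τ : Model.{u}) (p : ℕ) : Prop :=
  ∀ q, p < q + 1 → ∀ (c : Side) (T : Coh) (K : Coh.globe c (q + 1) ⟶ T),
    τ.functor.map (Coh.legHom false c (Nat.le_succ q) ≫ K).op =
      τ.functor.map (Coh.legHom true c (Nat.le_succ q) ≫ K).op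

end Model
/-! ### Pseudo-2-natural transformations

The coherator has no operation that adds an identity to an arbitrary cell: `0`-cells need not have
an identity `1`-cell, and only composites and values of the functors and of the transformation
have an identity `2`-cell. The following notions are those of bicategory, pseudo-2-functor and
pseudo-2-natural transformation that make sense in this setting. -/

/-- The data of a bicategory: cells, compositions, whiskerings, identity `2`-cells of composite
`1`-cells, and associators. -/
structure BicatData where
  Ob : Type u
  Hom : Ob → Ob → Type u
  Hom2 : ∀ {x y : Ob}, Hom x y → Hom x y → Type u
  comp : ∀ {x y z : Ob}, Hom y z → Hom x y → Hom x z
  vcomp : ∀ {x y : Ob} {f g h : Hom x y}, Hom2 g h → Hom2 f g → Hom2 f h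
  hcomp : ∀ {x y z : Ob} {g g' : Hom y z} {f f' : Hom x y},
    Hom2 g g' → Hom2 f f' → Hom2 (comp g f) (comp g' f')
  whiskerL : ∀ {x y z : Ob} (g : Hom y z) {f f' : Hom x y},
    Hom2 f f' → Hom2 (comp g f) (comp g f')
  whiskerR : ∀ {x y z : Ob} {g g' : Hom y z}, Hom2 g g' → ∀ (f : Hom x y),
    Hom2 (comp g f) (comp g' f)
  one : ∀ {x y z : Ob} (g : Hom y z) (f : Hom x y), Hom2 (comp g f) (comp g f)
  assoc : ∀ {x y z t : Ob} (h : Hom z t) (g : Hom y z) (f : Hom x y),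
    Hom2 (comp h (comp g f)) (comp (comp h g) f)
  assocInv : ∀ {x y z t : Ob} (h : Hom z t) (g : Hom y z) (f : Hom x y),
    Hom2 (comp (comp h g) f) (comp h (comp g f))

infixr:80 " ∘₁ " => BicatData.comp _
infixl:65 " ∘ᵥ " => BicatData.vcomp _
infixr:75 " ∘ₕ " => BicatData.hcomp _
infixr:75 " ◁₁ " => BicatData.whiskerL _
infixl:76 " ▷₁ " => BicatData.whiskerR _

/-- The axioms of a bicategory, without those on identity `1`-cells. -/
structure BicatData.IsBicategory (B : BicatData.{u}) : Prop where
  vassoc : ∀ {x y : B.Ob} {f g h k : B.Hom x y} (γ : B.Hom2 h k) (β : B.Hom2 g h)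
    (α : B.Hom2 f g), (γ ∘ᵥ β) ∘ᵥ α = γ ∘ᵥ (β ∘ᵥ α)
  interchange : ∀ {x y z : B.Ob} {g g' g'' : B.Hom y z} {f f' f'' : B.Hom x y}
    (β' : B.Hom2 g' g'') (β : B.Hom2 g g') (α' : B.Hom2 f' f'') (α : B.Hom2 f f'),
    (β' ∘ᵥ β) ∘ₕ (α' ∘ᵥ α) = (β' ∘ₕ α') ∘ᵥ (β ∘ₕ α)
  hcomp_eq : ∀ {x y z : B.Ob} {g g' : B.Hom y z} {f f' : B.Hom x y}
    (β : B.Hom2 g g') (α : B.Hom2 f f'), β ∘ₕ α = (β ▷₁ f') ∘ᵥ (g ◁₁ α)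
  hcomp_eq' : ∀ {x y z : B.Ob} {g g' : B.Hom y z} {f f' : B.Hom x y}
    (β : B.Hom2 g g') (α : B.Hom2 f f'), β ∘ₕ α = (g' ◁₁ α) ∘ᵥ (β ▷₁ f)
  whiskerL_vcomp : ∀ {x y z : B.Ob} (g : B.Hom y z) {f f' f'' : B.Hom x y}
    (α' : B.Hom2 f' f'') (α : B.Hom2 f f'), g ◁₁ (α' ∘ᵥ α) = (g ◁₁ α') ∘ᵥ (g ◁₁ α)
  whiskerR_vcomp : ∀ {x y z : B.Ob} {g g' g'' : B.Hom y z} (β' : B.Hom2 g' g'')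
    (β : B.Hom2 g g') (f : B.Hom x y), (β' ∘ᵥ β) ▷₁ f = (β' ▷₁ f) ∘ᵥ (β ▷₁ f)
  one_one : ∀ {x y z : B.Ob} (g : B.Hom y z) (f : B.Hom x y), B.one g f ∘ᵥ B.one g f = B.one g f
  one_whiskerL : ∀ {x y z : B.Ob} (g : B.Hom y z) {f f' : B.Hom x y} (α : B.Hom2 f f'),
    B.one g f' ∘ᵥ (g ◁₁ α) = g ◁₁ α
  whiskerL_one : ∀ {x y z : B.Ob} (g : B.Hom y z) {f f' : B.Hom x y} (α : B.Hom2 f f'),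
    (g ◁₁ α) ∘ᵥ B.one g f = g ◁₁ α
  one_whiskerR : ∀ {x y z : B.Ob} {g g' : B.Hom y z} (β : B.Hom2 g g') (f : B.Hom x y),
    B.one g' f ∘ᵥ (β ▷₁ f) = β ▷₁ f
  whiskerR_one : ∀ {x y z : B.Ob} {g g' : B.Hom y z} (β : B.Hom2 g g') (f : B.Hom x y),
    (β ▷₁ f) ∘ᵥ B.one g f = β ▷₁ f
  assoc_assocInv : ∀ {x y z t : B.Ob} (h : B.Hom z t) (g : B.Hom y z) (f : B.Hom x y),
    B.assoc h g f ∘ᵥ B.assocInv h g f = B.one (h ∘₁ g) f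
  assocInv_assoc : ∀ {x y z t : B.Ob} (h : B.Hom z t) (g : B.Hom y z) (f : B.Hom x y),
    B.assocInv h g f ∘ᵥ B.assoc h g f = B.one h (g ∘₁ f)
  assoc_one : ∀ {x y z t : B.Ob} (h : B.Hom z t) (g : B.Hom y z) (f : B.Hom x y),
    B.assoc h g f ∘ᵥ B.one h (g ∘₁ f) = B.assoc h g f
  one_assocInv : ∀ {x y z t : B.Ob} (h : B.Hom z t) (g : B.Hom y z) (f : B.Hom x y),
    B.one h (g ∘₁ f) ∘ᵥ B.assocInv h g f = B.assocInv h g f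
  assoc_natural_left : ∀ {x y z t : B.Ob} {h h' : B.Hom z t} (γ : B.Hom2 h h') (g : B.Hom y z)
    (f : B.Hom x y), B.assoc h' g f ∘ᵥ (γ ▷₁ (g ∘₁ f)) = ((γ ▷₁ g) ▷₁ f) ∘ᵥ B.assoc h g f
  assoc_natural_middle : ∀ {x y z t : B.Ob} (h : B.Hom z t) {g g' : B.Hom y z} (β : B.Hom2 g g')
    (f : B.Hom x y), B.assoc h g' f ∘ᵥ (h ◁₁ (β ▷₁ f)) = ((h ◁₁ β) ▷₁ f) ∘ᵥ B.assoc h g f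
  assoc_natural_right : ∀ {x y z t : B.Ob} (h : B.Hom z t) (g : B.Hom y z) {f f' : B.Hom x y}
    (α : B.Hom2 f f'), B.assoc h g f' ∘ᵥ (h ◁₁ (g ◁₁ α)) = ((h ∘₁ g) ◁₁ α) ∘ᵥ B.assoc h g f
  pentagon : ∀ {x y z t v : B.Ob} (k : B.Hom t v) (h : B.Hom z t) (g : B.Hom y z) (f : B.Hom x y),
    B.assoc (k ∘₁ h) g f ∘ᵥ B.assoc k h (g ∘₁ f) =
      (B.assoc k h g ▷₁ f) ∘ᵥ (B.assoc k (h ∘₁ g) f ∘ᵥ (k ◁₁ B.assoc h g f))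

/-- The data of a pseudo-2-functor; `one f` is the identity `2`-cell of `map f`. -/
structure PseudofunctorData (A B : BicatData.{u}) where
  obj : A.Ob → B.Ob
  map : ∀ {x y : A.Ob}, A.Hom x y → B.Hom (obj x) (obj y)
  map2 : ∀ {x y : A.Ob} {f g : A.Hom x y}, A.Hom2 f g → B.Hom2 (map f) (map g)
  one : ∀ {x y : A.Ob} (f : A.Hom x y), B.Hom2 (map f) (map f)
  d : ∀ {x y z : A.Ob} (g : A.Hom y z) (f : A.Hom x y), B.Hom2 (map g ∘₁ map f) (map (g ∘₁ f))
  dInv : ∀ {x y z : A.Ob} (g : A.Hom y z) (f : A.Hom x y), B.Hom2 (map (g ∘₁ f)) (map g ∘₁ map f)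

/-- The axioms of a pseudo-2-functor, without those on identity `1`-cells. -/
structure PseudofunctorData.IsPseudofunctor {A B : BicatData.{u}} (F : PseudofunctorData A B) :
    Prop where
  map2_vcomp : ∀ {x y : A.Ob} {f g h : A.Hom x y} (β : A.Hom2 g h) (α : A.Hom2 f g),
    F.map2 (β ∘ᵥ α) = F.map2 β ∘ᵥ F.map2 α
  one_one : ∀ {x y : A.Ob} (f : A.Hom x y), F.one f ∘ᵥ F.one f = F.one f
  one_map2 : ∀ {x y : A.Ob} {f g : A.Hom x y} (α : A.Hom2 f g), F.one g ∘ᵥ F.map2 α = F.map2 α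
  map2_one : ∀ {x y : A.Ob} {f g : A.Hom x y} (α : A.Hom2 f g), F.map2 α ∘ᵥ F.one f = F.map2 α
  one_comp : ∀ {x y z : A.Ob} (g : A.Hom y z) (f : A.Hom x y), F.map2 (A.one g f) = F.one (g ∘₁ f)
  one_hcomp_one : ∀ {x y z : A.Ob} (g : A.Hom y z) (f : A.Hom x y),
    F.one g ∘ₕ F.one f = B.one (F.map g) (F.map f)
  d_dInv : ∀ {x y z : A.Ob} (g : A.Hom y z) (f : A.Hom x y),
    F.d g f ∘ᵥ F.dInv g f = F.one (g ∘₁ f)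
  dInv_d : ∀ {x y z : A.Ob} (g : A.Hom y z) (f : A.Hom x y),
    F.dInv g f ∘ᵥ F.d g f = B.one (F.map g) (F.map f)
  one_d : ∀ {x y z : A.Ob} (g : A.Hom y z) (f : A.Hom x y), F.one (g ∘₁ f) ∘ᵥ F.d g f = F.d g f
  dInv_one : ∀ {x y z : A.Ob} (g : A.Hom y z) (f : A.Hom x y),
    F.dInv g f ∘ᵥ F.one (g ∘₁ f) = F.dInv g f
  d_natural_left : ∀ {x y z : A.Ob} {g g' : A.Hom y z} (β : A.Hom2 g g') (f : A.Hom x y),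
    F.d g' f ∘ᵥ (F.map2 β ∘ₕ F.one f) = F.map2 (β ▷₁ f) ∘ᵥ F.d g f
  d_natural_right : ∀ {x y z : A.Ob} (g : A.Hom y z) {f f' : A.Hom x y} (α : A.Hom2 f f'),
    F.d g f' ∘ᵥ (F.one g ∘ₕ F.map2 α) = F.map2 (g ◁₁ α) ∘ᵥ F.d g f
  map2_assoc : ∀ {x y z t : A.Ob} (h : A.Hom z t) (g : A.Hom y z) (f : A.Hom x y),
    F.map2 (A.assoc h g f) ∘ᵥ (F.d h (g ∘₁ f) ∘ᵥ (F.one h ∘ₕ F.d g f)) =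
      F.d (h ∘₁ g) f ∘ᵥ ((F.d h g ∘ₕ F.one f) ∘ᵥ B.assoc (F.map h) (F.map g) (F.map f))

/-- The data of a pseudo-2-natural transformation; `one x` is the identity `2`-cell of `app x`. -/
structure PseudonatData {A B : BicatData.{u}} (F H : PseudofunctorData A B) where
  app : ∀ x : A.Ob, B.Hom (F.obj x) (H.obj x)
  one : ∀ x : A.Ob, B.Hom2 (app x) (app x)
  ω : ∀ {x y : A.Ob} (a : A.Hom x y), B.Hom2 (H.map a ∘₁ app x) (app y ∘₁ F.map a)
  ωInv : ∀ {x y : A.Ob} (a : A.Hom x y), B.Hom2 (app y ∘₁ F.map a) (H.map a ∘₁ app x)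

namespace PseudonatData

variable {A B : BicatData.{u}} {F H : PseudofunctorData A B} (τ : PseudonatData F H)

/-- The composite `(ABCDEF)` of the hexagonal coherence diagram. -/
def pathABCDEF {x y z : A.Ob} (b : A.Hom y z) (a : A.Hom x y) :
    B.Hom2 (H.map b ∘₁ (H.map a ∘₁ τ.app x)) (τ.app z ∘₁ F.map (b ∘₁ a)) :=
  (τ.one z ∘ₕ F.d b a) ∘ᵥ B.assocInv (τ.app z) (F.map b) (F.map a) ∘ᵥ (τ.ω b ∘ₕ F.one a) ∘ᵥ
    B.assoc (H.map b) (τ.app y) (F.map a) ∘ᵥ (H.one b ∘ₕ τ.ω a)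

/-- The composite `(AGHF)` of the hexagonal coherence diagram. -/
def pathAGHF {x y z : A.Ob} (b : A.Hom y z) (a : A.Hom x y) :
    B.Hom2 (H.map b ∘₁ (H.map a ∘₁ τ.app x)) (τ.app z ∘₁ F.map (b ∘₁ a)) :=
  τ.ω (b ∘₁ a) ∘ᵥ (H.d b a ∘ₕ τ.one x) ∘ᵥ B.assoc (H.map b) (H.map a) (τ.app x)

/-- The axioms of a pseudo-2-natural transformation, without the one on identity `1`-cells. -/
structure IsPseudonatural : Prop where
  one_one : ∀ x, τ.one x ∘ᵥ τ.one x = τ.one x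
  one_hcomp_one : ∀ {x y : A.Ob} (a : A.Hom x y), H.one a ∘ₕ τ.one x = B.one (H.map a) (τ.app x)
  one_hcomp_one' : ∀ {x y : A.Ob} (a : A.Hom x y), τ.one y ∘ₕ F.one a = B.one (τ.app y) (F.map a)
  ω_ωInv : ∀ {x y : A.Ob} (a : A.Hom x y), τ.ω a ∘ᵥ τ.ωInv a = B.one (τ.app y) (F.map a)
  ωInv_ω : ∀ {x y : A.Ob} (a : A.Hom x y), τ.ωInv a ∘ᵥ τ.ω a = B.one (H.map a) (τ.app x)
  ω_one : ∀ {x y : A.Ob} (a : A.Hom x y), τ.ω a ∘ᵥ B.one (H.map a) (τ.app x) = τ.ω a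
  one_ωInv : ∀ {x y : A.Ob} (a : A.Hom x y), B.one (H.map a) (τ.app x) ∘ᵥ τ.ωInv a = τ.ωInv a
  ω_natural : ∀ {x y : A.Ob} {a a' : A.Hom x y} (α : A.Hom2 a a'),
    τ.ω a' ∘ᵥ (H.map2 α ∘ₕ τ.one x) = (τ.one y ∘ₕ F.map2 α) ∘ᵥ τ.ω a
  hexagon : ∀ {x y z : A.Ob} (b : A.Hom y z) (a : A.Hom x y), τ.pathABCDEF b a = τ.pathAGHF b a

end PseudonatData

/-! ### The pseudo-2-natural transformation of a model -/

/-- The tree of a `2`-cell `α : f ⟶ f'` followed by a `1`-cell `g` along a `0`-cell. -/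
def Tree.whiskerL (c : Side) : Tree :=
  .two (.glob true c (Nat.zero_le 2)) (.glob false c (Nat.zero_le 1))

/-- The tree of a `1`-cell `f` followed by a `2`-cell `β : g ⟶ g'` along a `0`-cell. -/
def Tree.whiskerR (c : Side) : Tree :=
  .two (.glob true c (Nat.zero_le 1)) (.glob false c (Nat.zero_le 2))

namespace PreOp

/-- The generic `2`-cell of the tree `Tree.whiskerL c`. -/
def whiskerLCell (c : Side) : PreOp (.whiskerL c) c 2 :=
  .var ((Tree.whiskerL c).gen (0 : Fin 2))

/-- The generic `1`-cell of the tree `Tree.whiskerL c`. -/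
def whiskerLArrow (c : Side) : PreOp (.whiskerL c) c 1 :=
  .var ((Tree.whiskerL c).gen (1 : Fin 2))

/-- The generic `1`-cell of the tree `Tree.whiskerR c`. -/
def whiskerRArrow (c : Side) : PreOp (.whiskerR c) c 1 :=
  .var ((Tree.whiskerR c).gen (0 : Fin 2))

/-- The generic `2`-cell of the tree `Tree.whiskerR c`. -/
def whiskerRCell (c : Side) : PreOp (.whiskerR c) c 2 :=
  .var ((Tree.whiskerR c).gen (1 : Fin 2))

/-- The generic `1`-cells of a chain of `k + 1` composable `1`-cells; the first is `arr 0`. -/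
def arr {c : Side} {k : ℕ} (l : Fin (k + 1)) : PreOp (.chain c (Nat.zero_le 1) k) c 1 :=
  cvar _ l

end PreOp

open PreOp in
/-- A choice of liftings in the coherator giving the coherence cells: the whiskerings, the
identities of composite `1`-cells, the associators, the identities of the values of the functors
and of the transformation, the functoriality constraints, and the naturality constraint. -/
structure Liftings where
  whiskerL : ∀ c, PreOp (.whiskerL c) c 2
  whiskerL_lift : ∀ c, IsLifting (comp 0 0 (whiskerLArrow c) ((whiskerLCell c).bd false))
    (comp 0 0 (whiskerLArrow c) ((whiskerLCell c).bd true)) (whiskerL c)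
  whiskerR : ∀ c, PreOp (.whiskerR c) c 2
  whiskerR_lift : ∀ c, IsLifting (comp 0 0 ((whiskerRCell c).bd false) (whiskerRArrow c))
    (comp 0 0 ((whiskerRCell c).bd true) (whiskerRArrow c)) (whiskerR c)
  one : ∀ c, PreOp (.chain c (Nat.zero_le 1) 1) c 2
  one_lift : ∀ c, IsLifting (comp 0 0 (arr 1) (arr 0)) (comp 0 0 (arr 1) (arr 0)) (one c)
  assoc : ∀ c, PreOp (.chain c (Nat.zero_le 1) 2) c 2
  assoc_lift : ∀ c, IsLifting (comp 0 0 (arr 2) (comp 0 0 (arr 1) (arr 0)))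
    (comp 0 0 (comp 0 0 (arr 2) (arr 1)) (arr 0)) (assoc c)
  assocInv : ∀ c, PreOp (.chain c (Nat.zero_le 1) 2) c 2
  assocInv_lift : ∀ c, IsLifting (comp 0 0 (comp 0 0 (arr 2) (arr 1)) (arr 0))
    (comp 0 0 (arr 2) (comp 0 0 (arr 1) (arr 0))) (assocInv c)
  oneFn : Bool → PreOp (.single (.glob .X 1)) .Z 2
  oneFn_lift : ∀ δ, IsLifting (fn δ (gvar .X 1)) (fn δ (gvar .X 1)) (oneFn δ)
  d : Bool → PreOp (.chain .X (Nat.zero_le 1) 1) .Z 2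
  d_lift : ∀ δ, IsLifting (comp 0 0 (fn δ (arr 1)) (fn δ (arr 0)))
    (fn δ (comp 0 0 (arr 1) (arr 0))) (d δ)
  dInv : Bool → PreOp (.chain .X (Nat.zero_le 1) 1) .Z 2
  dInv_lift : ∀ δ, IsLifting (fn δ (comp 0 0 (arr 1) (arr 0)))
    (comp 0 0 (fn δ (arr 1)) (fn δ (arr 0))) (dInv δ)
  oneNat : PreOp (.single (.glob .X 0)) .Z 2
  oneNat_lift : IsLifting (nat (gvar .X 0)) (nat (gvar .X 0)) oneNat
  ω : PreOp (.single (.glob .X 1)) .Z 2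
  ω_lift : IsLifting (comp 0 0 (fn true (gvar .X 1)) (nat ((gvar .X 1).bd false)))
    (comp 0 0 (nat ((gvar .X 1).bd true)) (fn false (gvar .X 1))) ω
  ωInv : PreOp (.single (.glob .X 1)) .Z 2
  ωInv_lift : IsLifting (comp 0 0 (nat ((gvar .X 1).bd true)) (fn false (gvar .X 1)))
    (comp 0 0 (fn true (gvar .X 1)) (nat ((gvar .X 1).bd false))) ωInv

namespace Model

variable {τ : Model.{u}} {c : Side}

/-- The `1`-cells from `x` to `y`. -/
def Hom (x y : τ.cell c 0) : Type u :=
  {f : τ.cell c 1 // τ.bd false f = x ∧ τ.bd true f = y}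

/-- The `2`-cells from `f` to `g`. -/
def Hom2 {x y : τ.cell c 0} (f g : Hom x y) : Type u :=
  {α : τ.cell c 2 // τ.bd false α = f.1 ∧ τ.bd true α = g.1}

variable {x y z t : τ.cell c 0}

theorem Hom2.bdTo_src {f g : Hom x y} (α : Hom2 f g) : τ.bdTo false (Nat.zero_le 2) α.1 = x :=
  (bd_bd_eq_bdTo false false α.1).symm.trans ((congrArg _ α.2.1).trans f.2.1)

theorem Hom2.bdTo_tgt {f g : Hom x y} (α : Hom2 f g) : τ.bdTo true (Nat.zero_le 2) α.1 = y :=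
  (bd_bd_eq_bdTo true false α.1).symm.trans ((congrArg _ α.2.1).trans f.2.2)

theorem Hom.comp_ok (g : Hom y z) (f : Hom x y) :
    τ.bdTo true (Nat.zero_le 1) f.1 = τ.bdTo false (Nat.zero_le 1) g.1 :=
  f.2.2.trans g.2.1.symm

/-- Composition of `1`-cells along a `0`-cell. -/
noncomputable def Hom.comp (g : Hom y z) (f : Hom x y) : Hom x z :=
  ⟨τ.comp 0 0 g.1 f.1 (g.comp_ok f), (bd_comp_zero false _ _ _).trans f.2.1,
    (bd_comp_zero true _ _ _).trans g.2.2⟩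

/-- Composition of `2`-cells along a `1`-cell. -/
noncomputable def Hom2.vcomp {f g h : Hom x y} (β : Hom2 g h) (α : Hom2 f g) : Hom2 f h :=
  ⟨τ.comp 1 0 β.1 α.1 (α.2.2.trans β.2.1.symm), (bd_comp_zero false _ _ _).trans α.2.1,
    (bd_comp_zero true _ _ _).trans β.2.2⟩

theorem bd_comp_zero_one (ε : Bool) {β α : τ.cell c 2} {g : Hom y z} {f : Hom x y}
    (hβ : τ.bd ε β = g.1) (hα : τ.bd ε α = f.1) (e) :
    τ.bd ε (τ.comp 0 1 β α e) = (g.comp f).1 := by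
  have e' : τ.bdTo true (Nat.zero_le 1) (τ.bd ε α) = τ.bdTo false (Nat.zero_le 1) (τ.bd ε β) := by
    rw [hα, hβ]
    exact g.comp_ok f
  exact (bd_comp_succ (k := 0) ε β α e e').trans (comp_congr hβ hα)

/-- Composition of `2`-cells along a `0`-cell. -/
noncomputable def Hom2.hcomp {g g' : Hom y z} {f f' : Hom x y} (β : Hom2 g g') (α : Hom2 f f') :
    Hom2 (g.comp f) (g'.comp f') :=
  ⟨τ.comp 0 1 β.1 α.1 (α.bdTo_tgt.trans β.bdTo_src.symm), bd_comp_zero_one false β.2.1 α.2.1 _,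
    bd_comp_zero_one true β.2.2 α.2.2 _⟩

/-- A lifting evaluated in a model. -/
noncomputable def ofLifting {T : Tree} {a b : PreOp T c 1} {k : PreOp T c 2}
    (h : PreOp.IsLifting a b k) (w : τ.functor.obj (op (Coh.mk T))) {f g : Hom x y}
    (ha : τ.eval a h.left w = f.1) (hb : τ.eval b h.right w = g.1) : Hom2 f g :=
  ⟨τ.eval k h.isOp w, (bd_src_eval h w).trans ha, (bd_tgt_eval h w).trans hb⟩

theorem eval_comp_eq {T : Tree} {b a : PreOp T c 1} {ht : ∃ n, IsOp n (.comp 0 0 b a)}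
    (hb : ∃ n, IsOp n b) (ha : ∃ n, IsOp n a) {w : τ.functor.obj (op (Coh.mk T))} {g : Hom y z}
    {f : Hom x y} (eg : τ.eval b hb w = g.1) (ef : τ.eval a ha w = f.1) :
    τ.eval (.comp 0 0 b a) ht w = (g.comp f).1 :=
  (eval_comp ht hb ha w (by rw [eg, ef]; exact g.comp_ok f)).trans (comp_congr eg ef)

/-- A `2`-cell and a `1`-cell composable along a `0`-cell, as an element of the model. -/
noncomputable def whiskerLPair (g : Hom y z) {f f' : Hom x y} (α : Hom2 f f') :
    τ.functor.obj (op (Coh.mk (.whiskerL c))) :=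
  τ.glue (.whiskerL c)
    (Fin.cases (motive := fun l : Fin 2 => τ.functor.obj (op (Coh.mk (.single
      ((Tree.whiskerL c).top l))))) α.1 (Fin.cases (n := 0) g.1 fun l => l.elim0))
    (Fin.cases (n := 0) (α.bdTo_tgt.trans g.2.1.symm) fun l => l.elim0)

/-- A `1`-cell and a `2`-cell composable along a `0`-cell, as an element of the model. -/
noncomputable def whiskerRPair {g g' : Hom y z} (β : Hom2 g g') (f : Hom x y) :
    τ.functor.obj (op (Coh.mk (.whiskerR c))) :=
  τ.glue (.whiskerR c)
    (Fin.cases (motive := fun l : Fin 2 => τ.functor.obj (op (Coh.mk (.single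
      ((Tree.whiskerR c).top l))))) f.1 (Fin.cases (n := 0) β.1 fun l => l.elim0))
    (Fin.cases (n := 0) (f.2.2.trans β.bdTo_src.symm) fun l => l.elim0)

theorem eval_whiskerLCell {g : Hom y z} {f f' : Hom x y} {α : Hom2 f f'} {ht} :
    τ.eval (.whiskerLCell c) ht (whiskerLPair g α) = α.1 :=
  (map_eq_eval (Coh.incl (.whiskerL c) (0 : Fin 2)) ht rfl _).symm.trans (map_incl_glue _)

theorem eval_whiskerLArrow {g : Hom y z} {f f' : Hom x y} {α : Hom2 f f'} {ht} :
    τ.eval (.whiskerLArrow c) ht (whiskerLPair g α) = g.1 :=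
  (map_eq_eval (Coh.incl (.whiskerL c) (1 : Fin 2)) ht rfl _).symm.trans (map_incl_glue _)

theorem eval_whiskerRArrow {g g' : Hom y z} {β : Hom2 g g'} {f : Hom x y} {ht} :
    τ.eval (.whiskerRArrow c) ht (whiskerRPair β f) = f.1 :=
  (map_eq_eval (Coh.incl (.whiskerR c) (0 : Fin 2)) ht rfl _).symm.trans (map_incl_glue _)

theorem eval_whiskerRCell {g g' : Hom y z} {β : Hom2 g g'} {f : Hom x y} {ht} :
    τ.eval (.whiskerRCell c) ht (whiskerRPair β f) = β.1 :=
  (map_eq_eval (Coh.incl (.whiskerR c) (1 : Fin 2)) ht rfl _).symm.trans (map_incl_glue _)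

/-- Two composable `1`-cells, as an element of the model. -/
noncomputable def homPair (g : Hom y z) (f : Hom x y) :
    τ.functor.obj (op (Coh.mk (.chain c (Nat.zero_le 1) 1))) :=
  τ.pair (Nat.zero_le 1) g.1 f.1 (g.comp_ok f)

/-- Three composable `1`-cells, as an element of the model. -/
noncomputable def homTriple (h : Hom z t) (g : Hom y z) (f : Hom x y) :
    τ.functor.obj (op (Coh.mk (.chain c (Nat.zero_le 1) 2))) :=
  τ.glue (.chain c (Nat.zero_le 1) 2)
    (Fin.cases (motive := fun _ : Fin 3 => τ.cell c 1) f.1 (Fin.cases g.1 fun _ => h.1))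
    (Fin.cases (n := 1) (g.comp_ok f) (Fin.cases (n := 0) (h.comp_ok g) fun l => l.elim0))

theorem eval_homPair_one {g : Hom y z} {f : Hom x y} {ht} :
    τ.eval (.arr (1 : Fin 2)) ht (homPair g f) = g.1 := eval_pair_one _

theorem eval_homPair_zero {g : Hom y z} {f : Hom x y} {ht} :
    τ.eval (.arr (0 : Fin 2)) ht (homPair g f) = f.1 := eval_pair_zero _

theorem eval_homTriple_two {h : Hom z t} {g : Hom y z} {f : Hom x y} {ht} :
    τ.eval (.arr (2 : Fin 3)) ht (homTriple h g f) = h.1 :=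
  (map_eq_eval (Coh.incl (.chain c (Nat.zero_le 1) 2) (2 : Fin 3)) ht rfl _).symm.trans
    (map_incl_glue _)

theorem eval_homTriple_one {h : Hom z t} {g : Hom y z} {f : Hom x y} {ht} :
    τ.eval (.arr (1 : Fin 3)) ht (homTriple h g f) = g.1 :=
  (map_eq_eval (Coh.incl (.chain c (Nat.zero_le 1) 2) (1 : Fin 3)) ht rfl _).symm.trans
    (map_incl_glue _)

theorem eval_homTriple_zero {h : Hom z t} {g : Hom y z} {f : Hom x y} {ht} :
    τ.eval (.arr (0 : Fin 3)) ht (homTriple h g f) = f.1 :=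
  (map_eq_eval (Coh.incl (.chain c (Nat.zero_le 1) 2) (0 : Fin 3)) ht rfl _).symm.trans
    (map_incl_glue _)

theorem isOp_arr {k : ℕ} (l : Fin (k + 1)) : ∃ n, IsOp n (.arr l : PreOp _ c 1) := ⟨0, .var _⟩

variable (τ) (L : Liftings)

/-- The underlying bicategory data of the domain `X` and of the codomain `Z` of a model. -/
noncomputable def bicat (c : Side) : BicatData.{u} where
  Ob := τ.cell c 0
  Hom := Hom
  Hom2 := Hom2
  comp := Hom.comp
  vcomp := Hom2.vcomp
  hcomp := Hom2.hcomp
  whiskerL g _ _ α := ofLifting (L.whiskerL_lift c) (whiskerLPair g α)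
    (eval_comp_eq ⟨0, .var _⟩ ⟨0, IsOp.bd (.var _) _⟩ eval_whiskerLArrow
      ((bd_eval _ _ ⟨0, .var _⟩ _).symm.trans ((congrArg _ eval_whiskerLCell).trans α.2.1)))
    (eval_comp_eq ⟨0, .var _⟩ ⟨0, IsOp.bd (.var _) _⟩ eval_whiskerLArrow
      ((bd_eval _ _ ⟨0, .var _⟩ _).symm.trans ((congrArg _ eval_whiskerLCell).trans α.2.2)))
  whiskerR β f := ofLifting (L.whiskerR_lift c) (whiskerRPair β f)
    (eval_comp_eq ⟨0, IsOp.bd (.var _) _⟩ ⟨0, .var _⟩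
      ((bd_eval _ _ ⟨0, .var _⟩ _).symm.trans ((congrArg _ eval_whiskerRCell).trans β.2.1))
      eval_whiskerRArrow)
    (eval_comp_eq ⟨0, IsOp.bd (.var _) _⟩ ⟨0, .var _⟩
      ((bd_eval _ _ ⟨0, .var _⟩ _).symm.trans ((congrArg _ eval_whiskerRCell).trans β.2.2))
      eval_whiskerRArrow)
  one g f := ofLifting (L.one_lift c) (homPair g f)
    (eval_comp_eq (isOp_arr _) (isOp_arr _) eval_homPair_one eval_homPair_zero)
    (eval_comp_eq (isOp_arr _) (isOp_arr _) eval_homPair_one eval_homPair_zero)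
  assoc h g f := ofLifting (L.assoc_lift c) (homTriple h g f)
    (eval_comp_eq (isOp_arr _) ((L.assoc_lift c).left.imp fun _ h => h.compOk.2.1)
      eval_homTriple_two
      (eval_comp_eq (isOp_arr _) (isOp_arr _) eval_homTriple_one eval_homTriple_zero))
    (eval_comp_eq ((L.assoc_lift c).right.imp fun _ h => h.compOk.1) (isOp_arr _)
      (eval_comp_eq (isOp_arr _) (isOp_arr _) eval_homTriple_two eval_homTriple_one)
      eval_homTriple_zero)
  assocInv h g f := ofLifting (L.assocInv_lift c) (homTriple h g f)
    (eval_comp_eq ((L.assoc_lift c).right.imp fun _ h => h.compOk.1) (isOp_arr _)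
      (eval_comp_eq (isOp_arr _) (isOp_arr _) eval_homTriple_two eval_homTriple_one)
      eval_homTriple_zero)
    (eval_comp_eq (isOp_arr _) ((L.assoc_lift c).left.imp fun _ h => h.compOk.2.1)
      eval_homTriple_two
      (eval_comp_eq (isOp_arr _) (isOp_arr _) eval_homTriple_one eval_homTriple_zero))

variable {τ} in
/-- The values of the functors on `1`-cells. -/
noncomputable def Hom.fn (δ : Bool) {x y : τ.cell .X 0} (f : Hom x y) :
    Hom (τ.fn δ x) (τ.fn δ y) :=
  ⟨τ.fn δ f.1, (bd_fn _ _ _).trans (congrArg _ f.2.1), (bd_fn _ _ _).trans (congrArg _ f.2.2)⟩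

variable {τ} in
theorem eval_fn_eq {T : Tree} {δ : Bool} {a : PreOp T .X 1} {ht : ∃ n, IsOp n (.fn δ a)}
    (ha : ∃ n, IsOp n a) {w : τ.functor.obj (op (Coh.mk T))} {x y : τ.cell .X 0} {f : Hom x y}
    (e : τ.eval a ha w = f.1) : τ.eval (.fn δ a) ht w = (f.fn δ).1 :=
  (eval_fn ht ha w).trans (congrArg _ e)

/-- The domain `F` (`δ = false`) and the codomain `H` (`δ = true`) of a model. -/
noncomputable def pseudofunctor (δ : Bool) :
    PseudofunctorData (τ.bicat L .X) (τ.bicat L .Z) where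
  obj x := τ.fn δ x
  map f := Hom.fn δ f
  map2 α := ⟨τ.fn δ α.1, (bd_fn _ _ _).trans (congrArg _ α.2.1),
    (bd_fn _ _ _).trans (congrArg _ α.2.2)⟩
  one f := ofLifting (L.oneFn_lift δ) f.1 rfl rfl
  d g f := ofLifting (L.d_lift δ) (homPair g f)
    (eval_comp_eq ⟨0, .fn _ (.var _)⟩ ⟨0, .fn _ (.var _)⟩
      (eval_fn_eq (isOp_arr _) eval_homPair_one) (eval_fn_eq (isOp_arr _) eval_homPair_zero))
    (eval_fn_eq (L.one_lift .X).left
      (eval_comp_eq (isOp_arr _) (isOp_arr _) eval_homPair_one eval_homPair_zero))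
  dInv g f := ofLifting (L.dInv_lift δ) (homPair g f)
    (eval_fn_eq (L.one_lift .X).left
      (eval_comp_eq (isOp_arr _) (isOp_arr _) eval_homPair_one eval_homPair_zero))
    (eval_comp_eq ⟨0, .fn _ (.var _)⟩ ⟨0, .fn _ (.var _)⟩
      (eval_fn_eq (isOp_arr _) eval_homPair_one) (eval_fn_eq (isOp_arr _) eval_homPair_zero))

variable {τ} in
/-- The components of a transformation, as `1`-cells from `F x` to `H x`. -/
noncomputable def natHom (x : τ.cell .X 0) : Hom (τ.fn false x) (τ.fn true x) :=
  ⟨τ.nat x, bd_nat false x, bd_nat true x⟩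

variable {τ} in
theorem eval_nat_bd (ε : Bool) {x : τ.cell .X 0} {f : τ.cell .X 1} (h : τ.bd ε f = x) {ht} :
    τ.eval (.nat ((PreOp.gvar .X 1).bd ε)) ht f = (natHom x).1 :=
  (eval_nat ht ⟨0, IsOp.bd (.var _) _⟩ f).trans
    (congrArg _ ((bd_eval _ _ ⟨0, .var _⟩ _).symm.trans ((congrArg _ (eval_gvar f)).trans h)))

/-- The pseudo-2-natural transformation data of a model. -/
noncomputable def pseudonat : PseudonatData (τ.pseudofunctor L false) (τ.pseudofunctor L true) where
  app x := natHom x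
  one x := ofLifting L.oneNat_lift x rfl rfl
  ω a := ofLifting L.ω_lift a.1
    (eval_comp_eq ⟨0, .fn _ (.var _)⟩ ⟨0, .nat (IsOp.bd (.var _) _)⟩
      (eval_fn_eq ⟨0, .var _⟩ (eval_gvar _)) (eval_nat_bd false a.2.1))
    (eval_comp_eq ⟨0, .nat (IsOp.bd (.var _) _)⟩ ⟨0, .fn _ (.var _)⟩
      (eval_nat_bd true a.2.2) (eval_fn_eq ⟨0, .var _⟩ (eval_gvar _)))
  ωInv a := ofLifting L.ωInv_lift a.1
    (eval_comp_eq ⟨0, .nat (IsOp.bd (.var _) _)⟩ ⟨0, .fn _ (.var _)⟩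
      (eval_nat_bd true a.2.2) (eval_fn_eq ⟨0, .var _⟩ (eval_gvar _)))
    (eval_comp_eq ⟨0, .fn _ (.var _)⟩ ⟨0, .nat (IsOp.bd (.var _) _)⟩
      (eval_fn_eq ⟨0, .var _⟩ (eval_gvar _)) (eval_nat_bd false a.2.1))

end Model
end WeakTrans

/-! Every axiom asserts that two 2-cells of a model with the same source and target coincide. In a
model of dimension 2 this holds as soon as both are the values, at the same element, of two parallel
algebraic 2-operations. Such a pair is admissible, so the coherator contains a 3-operation from one
to the other, and the dimension condition identifies the values of its source and target
(`eval_eq_of_isLifting`). What remains is to exhibit both sides of each axiom as values of parallel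
algebraic operations, without writing these operations down as formal expressions.

This is done with representable models. For a tree `T`, the functor represented by `T` is itself a
model `repr T`, whose cells are the operations of arity `T`; so every composite that makes sense in
all models, such as a side of the pentagon or of the hexagon, can be formed in `repr T` and is then
an operation. By the Yoneda lemma, an element `w` of shape `T` in a model `τ` is a natural map `ev
w` from `repr T` to `τ`, and this map carries each construction of `repr T` to the same construction
in `τ`. A composable configuration in `τ` is an element of shape a suitable tree, hence the image of
the generic configuration, formed by the coprojections of that tree (`exists_generic`). Both sides
of an axiom are therefore the images of the two sides formed from generic cells (`eq_of_ev`).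

Parallelism costs nothing: both generic sides are elements of one type `Hom2 f g`. Algebraicity
comes from the source: the boundary of a cell of the tree is a cell of the tree, so a 2-cell whose
source is a composite, a value of a functor or a component of the transformation is algebraic
(`Hom.Algebraic.hom2`). Only the associativity of vertical composition needs another argument, since
there the generic source may be a cell of the tree; both sides are then algebraic because they are
themselves composites.

The existence of a choice of liftings rests on the same device: each required pair is realised by
two arrows of a representable model with the same endpoints. The 3-operation of the hexagon is a
lifting of the two paths formed in the model represented by the tree of two composable arrows; the
naturality of `ev` gives their values in every model, with no assumption on its dimension. -/

namespace WeakTrans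

open PreOp (IsOp)

namespace Model

/-! ### Representable models -/

/-- The model represented by a tree: its `m`-cells are the `m`-operations of this arity. -/
def repr (T : Tree) : Model.{0} where
  functor := yoneda.obj (Coh.mk T)
  segal S x hx := by
    have hx' : ∀ l, Coh.leg (S.tleg l) ≫ (x l.castSucc : _ ⟶ Coh.mk T) =
        Coh.leg (S.sleg l) ≫ (x l.succ : _ ⟶ Coh.mk T) := hx
    let a (l) (d : Side) (j : ℕ) (z : (S.top l).D.cell d j) : PreOp T d j :=
      Coh.Hom.app (x l : _ ⟶ Coh.mk T) d j (((Tree.single (S.top l)).incl 0).app z)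
    -- A morphism out of a globular sum is glued from its restrictions; it respects the gluing
    -- relation because that relation is generated by the legs, on which the restrictions agree by
    -- `hx'`.
    let b (d : Side) (j : ℕ) : S.real.cell d j → PreOp T d j :=
      Quot.lift (fun z => a z.1 d j z.2) (by
        rintro _ _ ⟨l, z⟩
        exact congrArg (fun φ => Coh.Hom.app φ d j
          (((Tree.single (S.bot l)).incl 0).app z)) (hx' l))
    have isOp (l) := Coh.Hom.isOp (x l : _ ⟶ Coh.mk T)
    choose n hn using isOp
    let w : Coh.mk S ⟶ Coh.mk T :=
      { app := b
        comm := by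
          intro ε d j z
          induction z using Quot.ind with
          | mk z => exact Coh.Hom.comm (x z.1 : _ ⟶ Coh.mk T) ε d j _
        isOp := by
          -- Each restriction lives in some finite stage of the sequence of theories. A tree has
          -- finitely many entries, so one stage contains them all; this finiteness is what makes
          -- the glued family a morphism of the colimit.
          refine ⟨Finset.univ.sup n, fun d j z => ?_⟩
          induction z using Quot.ind with
          | mk z => exact (hn z.1 _ _ _).mono (Finset.le_sup (Finset.mem_univ z.1)) }
    refine ⟨w, fun l => ?_, fun v hv => ?_⟩
    · refine Coh.Hom.ext ?_
      funext d j z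
      induction z using Quot.ind with
      | mk z =>
        obtain ⟨l', z⟩ := z
        obtain rfl : l' = 0 := Subsingleton.elim (α := Fin 1) _ _
        rfl
    -- Uniqueness: every cell of the globular sum is the image of a cell of some entry.
    · refine Coh.Hom.ext ?_
      funext d j z
      induction z using Quot.ind with
      | mk z =>
        exact congrArg (fun φ => Coh.Hom.app φ d j
          (((Tree.single (S.top z.1)).incl 0).app z.2)) (hv z.1)

variable {τ : Model.{u}} {T : Tree}

/-- The map from the model represented by `T` classified by an element of shape `T`. -/
def ev (w : τ.functor.obj (op (Coh.mk T))) {S : Coh} (v : (repr T).functor.obj (op S)) :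
    τ.functor.obj (op S) :=
  τ.functor.map (Quiver.Hom.op (v : S ⟶ Coh.mk T)) w

/-! ### Naturality of evaluation -/

section

variable {w : τ.functor.obj (op (Coh.mk T))} {c : Side}

theorem ev_map {R S : Coh} (φ : R ⟶ S) (v : (repr T).functor.obj (op S)) :
    ev w ((repr T).functor.map φ.op v) = τ.functor.map φ.op (ev w v) :=
  (map_comp_apply φ (v : S ⟶ Coh.mk T) w).symm

/-- An instance of naturality, as `t` acts through a morphism of the coherator. The value of the
argument is a separate variable `v'` with an equation, so that these lemmas nest: the value of a
compound expression is obtained by applying them along its syntax. -/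
theorem ev_eval {S : Tree} {m : ℕ} {t : PreOp S c m} {ht : ∃ n, IsOp n t}
    {v : (repr T).functor.obj (op (Coh.mk S))} {v'} (h : ev w v = v') :
    ev w ((repr T).eval t ht v) = τ.eval t ht v' := by
  subst h
  exact ev_map _ v

theorem ev_bdTo (ε : Bool) {p n : ℕ} (h : p ≤ n) {x : (repr T).cell c n} {x' : τ.cell c n}
    (hx : ev w x = x') : ev w ((repr T).bdTo ε h x) = τ.bdTo ε h x' := by
  subst hx
  exact ev_map _ x

theorem ev_bd (ε : Bool) {m : ℕ} {x : (repr T).cell c (m + 1)} {x' : τ.cell c (m + 1)}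
    (hx : ev w x = x') : ev w ((repr T).bd ε x) = τ.bd ε x' :=
  ev_bdTo ε _ hx

/-- The image of a glued family has the prescribed components by naturality, and a glued element is
determined by its components. -/
theorem ev_glue {S : Tree} {x : ∀ l, (repr T).functor.obj (op (Coh.mk (.single (S.top l))))} {hx}
    {x' : ∀ l, τ.functor.obj (op (Coh.mk (.single (S.top l))))} {hx'}
    (h : ∀ l, ev w (x l) = x' l) : ev w ((repr T).glue S x hx) = τ.glue S x' hx' := by
  refine eq_glue fun l => (ev_map _ _).symm.trans ((congrArg (ev w) ?_).trans (h l))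
  exact map_incl_glue (τ := repr T) l

theorem ev_pair {p n : ℕ} {h : p ≤ n} {y x : (repr T).cell c n} {e} {y' x' : τ.cell c n} {e'}
    (hy : ev w y = y') (hx : ev w x = x') :
    ev w ((repr T).pair h y x e) = τ.pair h y' x' e' :=
  ev_glue (Fin.cases hx fun _ => hy)

theorem ev_comp {p k : ℕ} {y x : (repr T).cell c (p + k + 1)} {e} {y' x' : τ.cell c (p + k + 1)}
    {e'} (hy : ev w y = y') (hx : ev w x = x') :
    ev w ((repr T).comp p k y x e) = τ.comp p k y' x' e' :=
  ev_eval (ev_pair hy hx)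

theorem ev_fn (δ : Bool) {m : ℕ} {x : (repr T).cell .X m} {x' : τ.cell .X m} (hx : ev w x = x') :
    ev w ((repr T).fn δ x) = τ.fn δ x' :=
  ev_eval hx

theorem ev_nat {x : (repr T).cell .X 0} {x' : τ.cell .X 0} (hx : ev w x = x') :
    ev w ((repr T).nat x) = τ.nat x' :=
  ev_eval hx

/-! ### The operation of a cell of a representable model -/

/-- Evaluation in a representable model is composition in the coherator, and composition there is
substitution. -/
theorem toOp_eval {S : Tree} {m : ℕ} {t : PreOp S c m} {ht : ∃ n, IsOp n t}
    (v : (repr T).functor.obj (op (Coh.mk S))) :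
    Coh.toOp ((repr T).eval t ht v) = t.subst (Coh.Hom.app (v : Coh.mk S ⟶ Coh.mk T)) :=
  congrArg (PreOp.subst _) (Coh.toOp_opHom t ht)

end

end Model

namespace Model

variable {τ : Model.{u}} {T : Tree} {c : Side}

theorem toOp_bd (ε : Bool) {m : ℕ} (x : (repr T).cell c (m + 1)) :
    Coh.toOp ((repr T).bd ε x) = (Coh.toOp x).bd ε := by
  -- Writing `x` as the value of the generic cell at `x` turns its boundary into the value of an
  -- operation, that is, into a substitution.
  have h : (repr T).bd ε x = (repr T).eval _ ⟨0, IsOp.bd (.var _) ε⟩ x :=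
    (congrArg _ (eval_gvar (ht := ⟨0, .var _⟩) x)).symm.trans (bd_eval ε (.gvar c (m + 1)) _ x)
  refine (congrArg Coh.toOp h).trans ((toOp_eval _).trans ?_)
  exact (PreOp.bd_subst ε _ (Coh.Hom.comm (x : Coh.globe c (m + 1) ⟶ Coh.mk T) ε)
    (.gvar c (m + 1))).symm

theorem toOp_comp {p k : ℕ} (y x : (repr T).cell c (p + k + 1)) (e) :
    Coh.toOp ((repr T).comp p k y x e) = .comp p k (Coh.toOp y) (Coh.toOp x) := by
  have h : p ≤ p + k + 1 := by omega
  refine (toOp_eval _).trans (congrArg₂ (PreOp.comp p k) ?_ ?_)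
  · exact (toOp_eval (ht := ⟨0, .var _⟩) _).symm.trans
      (congrArg Coh.toOp (eval_pair_one (τ := repr T) (y := y) (x := x) (e := e) h))
  · exact (toOp_eval (ht := ⟨0, .var _⟩) _).symm.trans
      (congrArg Coh.toOp (eval_pair_zero (τ := repr T) (y := y) (x := x) (e := e) h))

theorem toOp_fn (δ : Bool) {m : ℕ} (x : (repr T).cell .X m) :
    Coh.toOp ((repr T).fn δ x) = .fn δ (Coh.toOp x) :=
  toOp_eval _

theorem toOp_nat (x : (repr T).cell .X 0) : Coh.toOp ((repr T).nat x) = .nat (Coh.toOp x) :=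
  toOp_eval _

/-- The generic cells of a tree are composable in the model it represents, by the very relations
that define the globular sum. This supplies the endpoint equations of all generic configurations. -/
theorem repr_incl_glue (T : Tree) (l : Fin T.len) :
    (repr T).functor.map (Coh.leg (T.tleg l)).op (Coh.incl T l.castSucc) =
      (repr T).functor.map (Coh.leg (T.sleg l)).op (Coh.incl T l.succ) := by
  refine Coh.Hom.ext ?_
  funext d j z
  induction z using Quot.ind with
  | mk z => exact congrArg PreOp.var (T.incl_glue l z.2)

/-! ### Liftings of parallel cells -/

theorem not_isVar_comp {p k : ℕ} {y x : PreOp T c (p + k + 1)} : ¬ (PreOp.comp p k y x).IsVar :=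
  fun ⟨_, h⟩ => nomatch h

theorem not_isVar_fn {m : ℕ} {δ : Bool} {x : PreOp T .X m} : ¬ (PreOp.fn δ x).IsVar := by
  rintro ⟨_, h⟩
  cases h

theorem not_isVar_nat {x : PreOp T .X 0} : ¬ (PreOp.nat x).IsVar :=
  fun ⟨_, h⟩ => nomatch h

/-- The freely adjoined lifting, precomposed with the identity substitution, which leaves its source
and target unchanged. -/
theorem isLifting_lift {m : ℕ} {f g : PreOp T c m} (hf : ∃ n, IsOp n f) (hg : ∃ n, IsOp n g)
    (hp : f.Parallel g) (hf' : ¬ f.IsVar) (hg' : ¬ g.IsVar) :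
    PreOp.IsLifting f g (.lift T f g fun _ _ z => .var z) where
  left := hf
  right := hg
  parallel := hp
  left_algebraic := hf'
  right_algebraic := hg'
  isOp := by
    obtain ⟨n, hn⟩ := hf
    obtain ⟨n', hn'⟩ := hg
    -- The two operations may appear at different stages; they are moved to a common one, and their
    -- lifting appears at the next.
    exact ⟨max n n' + 1, .lift (hn.mono (le_max_left _ _)) (hn'.mono (le_max_right _ _)) hp hf' hg'
      (fun _ _ _ => .var _) fun _ _ _ _ => rfl⟩
  src := PreOp.subst_var f
  tgt := PreOp.subst_var g

theorem parallel_toOp {m : ℕ} {P Q : (repr T).cell c (m + 1)}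
    (h : ∀ ε, (repr T).bd ε P = (repr T).bd ε Q) : (Coh.toOp P).Parallel (Coh.toOp Q) := fun ε => by
  rw [← toOp_bd, ← toOp_bd, h]

/-- Membership in the same `Hom x y` is what makes the operations parallel. The explicit expressions
`f'` and `g'` serve to match the pairs prescribed in `Liftings`, and their algebraicity can be read
off from their outermost symbol. -/
theorem exists_isLifting {x y : (repr T).cell c 0} (f g : Hom x y) {f' g' : PreOp T c 1}
    (hf : Coh.toOp f.1 = f') (hg : Coh.toOp g.1 = g') (hf' : ¬ f'.IsVar) (hg' : ¬ g'.IsVar) :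
    ∃ h, PreOp.IsLifting f' g' h := by
  subst hf hg
  refine ⟨_, isLifting_lift (Coh.toOp_isOp _) (Coh.toOp_isOp _) (parallel_toOp ?_) hf' hg'⟩
  rintro (_ | _)
  exacts [f.2.1.trans g.2.1.symm, f.2.2.trans g.2.2.symm]

/-- The source and the target of a `2`-cell, as `1`-cells between `0`-cells. -/
def bdHom {x y : τ.cell c 0} (ε : Bool) (α : τ.cell c 2)
    (hx : τ.bdTo false (Nat.zero_le 2) α = x) (hy : τ.bdTo true (Nat.zero_le 2) α = y) :
    Hom x y :=
  ⟨τ.bd ε α, (bd_bd_eq_bdTo _ _ _).trans hx, (bd_bd_eq_bdTo _ _ _).trans hy⟩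

theorem toOp_hom_comp {x y z : (repr T).cell c 0} {g : Hom y z} {f : Hom x y}
    {g' f' : PreOp T c 1} (hg : Coh.toOp g.1 = g') (hf : Coh.toOp f.1 = f') :
    Coh.toOp (g.comp f).1 = .comp 0 0 g' f' := by
  subst hg hf
  exact toOp_comp _ _ _

theorem toOp_hom_fn {x y : (repr T).cell .X 0} (δ : Bool) {f : Hom x y}
    {f' : PreOp T .X 1} (hf : Coh.toOp f.1 = f') : Coh.toOp (f.fn δ).1 = .fn δ f' := by
  subst hf
  exact toOp_fn _ _

theorem toOp_natHom {x : (repr T).cell .X 0} {x' : PreOp T .X 0} (hx : Coh.toOp x = x') :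
    Coh.toOp (natHom x).1 = .nat x' := by
  subst hx
  exact toOp_nat _

/-- The generic cells of a chain of arrows. -/
def chainCell (c : Side) {k : ℕ} (l : Fin (k + 1)) :
    (repr (.chain c (Nat.zero_le 1) k)).cell c 1 :=
  Coh.incl (.chain c (Nat.zero_le 1) k) l

/-- The generic arrows of a chain. -/
def chainHom (c : Side) {k : ℕ} (l : Fin (k + 1)) :
    Hom ((repr _).bd false (chainCell c l)) ((repr _).bd true (chainCell c l)) :=
  ⟨chainCell c l, rfl, rfl⟩

/-- The generic arrows of a chain, except the first one, with the target of the preceding arrow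
as their source. -/
def chainHomSucc (c : Side) {k : ℕ} (l : Fin k) :
    Hom ((repr _).bd true (chainCell c l.castSucc)) ((repr _).bd true (chainCell c l.succ)) :=
  ⟨chainCell c l.succ, (repr_incl_glue (.chain c (Nat.zero_le 1) k) l).symm, rfl⟩

/-! ### Existence of a choice of liftings -/

theorem nonempty_liftings : Nonempty Liftings := by
  have whiskerL (c) := by
    let T := Tree.whiskerL c
    let α : (repr T).cell c 2 := Coh.incl T (0 : Fin 2)
    -- The source of the arrow is declared to be the 0-target of the 2-cell, which is legitimate by
    -- the gluing; both composites then have the same endpoints by their type.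
    let g : Hom (τ := repr T) (c := c) ((repr T).bdTo true (Nat.zero_le 2) α) _ :=
      ⟨Coh.incl T (1 : Fin 2), (repr_incl_glue T (0 : Fin 1)).symm, rfl⟩
    have h (ε) := toOp_hom_comp (g := g) (f := bdHom ε α rfl rfl) (g' := .whiskerLArrow c)
      (f' := (PreOp.whiskerLCell c).bd ε) rfl (toOp_bd ε α)
    exact exists_isLifting _ _ (h false) (h true) not_isVar_comp not_isVar_comp
  have whiskerR (c) := by
    let T := Tree.whiskerR c
    let β : (repr T).cell c 2 := Coh.incl T (1 : Fin 2)
    let f : Hom (τ := repr T) (c := c) _ ((repr T).bdTo false (Nat.zero_le 2) β) :=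
      ⟨Coh.incl T (0 : Fin 2), rfl, repr_incl_glue T (0 : Fin 1)⟩
    have h (ε) := toOp_hom_comp (g := bdHom ε β rfl rfl) (f := f)
      (g' := (PreOp.whiskerRCell c).bd ε) (f' := .whiskerRArrow c) (toOp_bd ε β) rfl
    exact exists_isLifting _ _ (h false) (h true) not_isVar_comp not_isVar_comp
  -- The index of `chainHomSucc` is that of the junction: `chainHomSucc c l` is arrow `l + 1`, with
  -- source the target of arrow `l`.
  have pair (c) := toOp_hom_comp (g := chainHomSucc c (0 : Fin 1)) (f := chainHom c (0 : Fin 2))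
    (g' := .arr (1 : Fin 2)) (f' := .arr (0 : Fin 2)) rfl rfl
  have left (c) := toOp_hom_comp (g := chainHomSucc c (1 : Fin 2)) (g' := .arr (2 : Fin 3)) rfl
    (toOp_hom_comp (g := chainHomSucc c (0 : Fin 2)) (f := chainHom c (0 : Fin 3))
      (g' := .arr (1 : Fin 3)) (f' := .arr (0 : Fin 3)) rfl rfl)
  have right (c) := toOp_hom_comp (toOp_hom_comp (g := chainHomSucc c (1 : Fin 2))
    (f := chainHomSucc c (0 : Fin 2)) (g' := .arr (2 : Fin 3)) (f' := .arr (1 : Fin 3)) rfl rfl)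
    (f := chainHom c (0 : Fin 3)) (f' := .arr (0 : Fin 3)) rfl
  have one (c) := exists_isLifting _ _ (pair c) (pair c) not_isVar_comp not_isVar_comp
  have assoc (c) := exists_isLifting _ _ (left c) (right c) not_isVar_comp not_isVar_comp
  have assocInv (c) := exists_isLifting _ _ (right c) (left c) not_isVar_comp not_isVar_comp
  -- The identity of the globe, seen as a cell of the model it represents, is the generic 1-cell.
  let a : Hom (τ := repr (.single (.glob .X 1))) (c := .X) _ _ :=
    ⟨𝟙 (Coh.globe .X 1), rfl, rfl⟩
  have ha : Coh.toOp a.1 = .gvar .X 1 := rfl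
  have oneFn (δ) := exists_isLifting _ _ (toOp_hom_fn δ ha) (toOp_hom_fn δ ha)
    not_isVar_fn not_isVar_fn
  have fnPair (δ) := toOp_hom_comp
    (toOp_hom_fn (f := chainHomSucc .X (0 : Fin 1)) (f' := .arr (1 : Fin 2)) δ rfl)
    (toOp_hom_fn (f := chainHom .X (0 : Fin 2)) (f' := .arr (0 : Fin 2)) δ rfl)
  have d (δ) := exists_isLifting _ _ (fnPair δ) (toOp_hom_fn δ (pair .X))
    not_isVar_comp not_isVar_fn
  have dInv (δ) := exists_isLifting _ _ (toOp_hom_fn δ (pair .X)) (fnPair δ)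
    not_isVar_fn not_isVar_comp
  have hx := toOp_natHom (T := .single (.glob .X 0)) (x := 𝟙 (Coh.globe .X 0))
    (x' := .gvar .X 0) rfl
  have oneNat := exists_isLifting _ _ hx hx not_isVar_nat not_isVar_nat
  -- The two sides of the naturality square of the generic arrow, both going from `F` of its source
  -- to `H` of its target.
  have src := toOp_hom_comp (toOp_hom_fn true ha) (toOp_natHom (toOp_bd false a.1))
  have tgt := toOp_hom_comp (toOp_natHom (toOp_bd true a.1)) (toOp_hom_fn false ha)
  have ω := exists_isLifting _ _ src tgt not_isVar_comp not_isVar_comp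
  have ωInv := exists_isLifting _ _ tgt src not_isVar_comp not_isVar_comp
  choose whiskerL whiskerL_lift using whiskerL
  choose whiskerR whiskerR_lift using whiskerR
  choose one one_lift using one
  choose assoc assoc_lift using assoc
  choose assocInv assocInv_lift using assocInv
  choose oneFn oneFn_lift using oneFn
  choose d d_lift using d
  choose dInv dInv_lift using dInv
  choose oneNat oneNat_lift using oneNat
  choose ω ω_lift using ω
  choose ωInv ωInv_lift using ωInv
  exact ⟨⟨whiskerL, whiskerL_lift, whiskerR, whiskerR_lift, one, one_lift, assoc, assoc_lift,
    assocInv, assocInv_lift, oneFn, oneFn_lift, d, d_lift, dInv, dInv_lift, oneNat, oneNat_lift,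
    ω, ω_lift, ωInv, ωInv_lift⟩⟩

end Model

namespace Model

/-! ### Parallel operations in a model of dimension `2` -/

/-- The values of `P` and `Q` are the source and target of the value of the `(q + 1)`-operation `K`,
and these are equalized because `q + 1 > p`. This is the only use of the dimension of the model. -/
theorem eval_eq_of_isLifting {τ : Model.{u}} {T : Tree} {c : Side} {q : ℕ} {P Q : PreOp T c q}
    {K : PreOp T c (q + 1)} {p : ℕ} (hτ : τ.HasDim p) (hq : p ≤ q) (h : PreOp.IsLifting P Q K)
    (w : τ.functor.obj (op (Coh.mk T))) : τ.eval P h.left w = τ.eval Q h.right w := by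
  have e := congrArg (fun φ : τ.functor.obj (op (Coh.mk T)) ⟶ _ => φ w)
    (hτ q (Nat.lt_succ_of_le hq) c ⟨T⟩ (Coh.opHom K h.isOp))
  exact (bd_src_eval h w).symm.trans ((map_comp_apply _ _ w).trans
    (e.trans ((map_comp_apply _ _ w).symm.trans (bd_tgt_eval h w))))

variable {τ : Model.{u}} {T : Tree} {c : Side}

/-- Links the two views of a cell of a representable model: a cell carried along by `ev`, and a
formal operation that can be lifted. -/
theorem ev_eq_eval {w : τ.functor.obj (op (Coh.mk T))} {m : ℕ} (P : (repr T).cell c m) {ht} :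
    ev w P = τ.eval (Coh.toOp P) ht w :=
  map_eq_eval (P : Coh.globe c m ⟶ Coh.mk T) _ rfl w

/-! ### Algebraic arrows and 2-cells -/

section Arrows

variable {x y : (repr T).cell c 0}

/-- An arrow of a representable model is algebraic if it is not a cell of the tree. -/
def Hom.Algebraic (f : Hom x y) : Prop := ¬ (Coh.toOp f.1).IsVar

theorem Hom.algebraic_comp {z : (repr T).cell c 0} (g : Hom y z) (f : Hom x y) :
    (g.comp f).Algebraic := by
  rw [Algebraic, toOp_hom_comp rfl rfl]
  exact not_isVar_comp

theorem Hom.algebraic_fn (δ : Bool) {x y : (repr T).cell .X 0} (f : Hom x y) :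
    (f.fn δ).Algebraic := by
  rw [Algebraic, toOp_hom_fn δ rfl]
  exact not_isVar_fn

theorem algebraic_natHom (x : (repr T).cell .X 0) : (natHom x).Algebraic := by
  rw [Hom.Algebraic, toOp_natHom rfl]
  exact not_isVar_nat

/-- A `2`-cell of a representable model is algebraic if it is not a cell of the tree. -/
def Hom2.Algebraic {f g : Hom x y} (α : Hom2 f g) : Prop := ¬ (Coh.toOp α.1).IsVar

/-- If the 2-cell were a cell of the tree, so would be its source. Hence it suffices to look at the
source, however complicated the 2-cell is. -/
theorem Hom.Algebraic.hom2 {f g : Hom x y} (hf : f.Algebraic) (α : Hom2 f g) : α.Algebraic := by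
  rintro ⟨v, hv⟩
  refine hf ⟨T.real.bd false v, ?_⟩
  rw [← α.2.1, toOp_bd, hv, PreOp.bd_var]

/-- Covers the case in which the source may itself be a cell of the tree, so that
`Hom.Algebraic.hom2` does not apply. -/
theorem Hom2.algebraic_vcomp {f g h : Hom x y} (β : Hom2 g h) (α : Hom2 f g) :
    (β.vcomp α).Algebraic :=
  fun h => not_isVar_comp ((congrArg PreOp.IsVar (toOp_comp (p := 1) (k := 0) β.1 α.1
    (α.2.2.trans β.2.1.symm))).mp h)

theorem exists_isLifting_of_hom2 {f g : Hom x y} {P Q : Hom2 f g} (hP : P.Algebraic)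
    (hQ : Q.Algebraic) : ∃ K, PreOp.IsLifting (Coh.toOp P.1) (Coh.toOp Q.1) K := by
  refine ⟨_, isLifting_lift (Coh.toOp_isOp _) (Coh.toOp_isOp _) (parallel_toOp ?_) hP hQ⟩
  rintro (_ | _)
  exacts [P.2.1.trans Q.2.1.symm, P.2.2.trans Q.2.2.symm]

/-- Parallel algebraic `2`-cells of a representable model have the same value in models of
dimension `2`. -/
theorem eq_of_ev (hτ : τ.HasDim 2) {w : τ.functor.obj (op (Coh.mk T))} {f g : Hom x y}
    {P Q : Hom2 f g} (hP : P.Algebraic) (hQ : Q.Algebraic) {x' y' : τ.cell c 0}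
    {f' g' : Hom x' y'} {α β : Hom2 f' g'} (hα : ev w P.1 = α.1) (hβ : ev w Q.1 = β.1) :
    α = β := by
  obtain ⟨K, hK⟩ := exists_isLifting_of_hom2 hP hQ
  refine Subtype.ext (hα.symm.trans (Eq.trans ?_ hβ))
  exact (ev_eq_eval _).trans ((eval_eq_of_isLifting hτ le_rfl hK w).trans (ev_eq_eval _).symm)

end Arrows

/-! ### Values of composites -/

section

variable {w : τ.functor.obj (op (Coh.mk T))} {x y z t : (repr T).cell c 0}
  {x' y' z' t' : τ.cell c 0} {f f₁ f₂ : Hom x y} {g g₁ : Hom y z} {h : Hom z t}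
  {f' f₁' f₂' : Hom x' y'} {g' g₁' : Hom y' z'} {h' : Hom z' t'}

/-- Here and below, only the underlying cells are compared. The endpoints on the side of `τ` are not
required to be written as images under `ev`, so no transport between types of arrows or of 2-cells
occurs. -/
theorem ev_hom_comp (hg : ev w g.1 = g'.1) (hf : ev w f.1 = f'.1) :
    ev w (g.comp f).1 = (g'.comp f').1 :=
  ev_comp hg hf

theorem ev_vcomp {β : Hom2 f₁ f₂} {α : Hom2 f f₁} {β' : Hom2 f₁' f₂'} {α' : Hom2 f' f₁'}
    (hβ : ev w β.1 = β'.1) (hα : ev w α.1 = α'.1) : ev w (β.vcomp α).1 = (β'.vcomp α').1 :=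
  ev_comp hβ hα

theorem ev_hcomp {β : Hom2 g g₁} {α : Hom2 f f₁} {β' : Hom2 g' g₁'} {α' : Hom2 f' f₁'}
    (hβ : ev w β.1 = β'.1) (hα : ev w α.1 = α'.1) : ev w (β.hcomp α).1 = (β'.hcomp α').1 :=
  ev_comp hβ hα

theorem ev_whiskerLPair {α : Hom2 f f₁} {α' : Hom2 f' f₁'} (hg : ev w g.1 = g'.1)
    (hα : ev w α.1 = α'.1) : ev w (whiskerLPair g α) = whiskerLPair g' α' :=
  ev_glue (Fin.cases hα (Fin.cases (n := 0) hg fun l => l.elim0))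

theorem ev_whiskerRPair {β : Hom2 g g₁} {β' : Hom2 g' g₁'} (hβ : ev w β.1 = β'.1)
    (hf : ev w f.1 = f'.1) : ev w (whiskerRPair β f) = whiskerRPair β' f' :=
  ev_glue (Fin.cases hf (Fin.cases (n := 0) hβ fun l => l.elim0))

theorem ev_homPair (hg : ev w g.1 = g'.1) (hf : ev w f.1 = f'.1) :
    ev w (homPair g f) = homPair g' f' :=
  ev_pair hg hf

theorem ev_homTriple (hh : ev w h.1 = h'.1) (hg : ev w g.1 = g'.1) (hf : ev w f.1 = f'.1) :
    ev w (homTriple h g f) = homTriple h' g' f' :=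
  ev_glue (Fin.cases hf (Fin.cases (n := 1) hg fun _ => hh))

variable (L : Liftings)

theorem ev_whiskerL {α : Hom2 f f₁} {α' : Hom2 f' f₁'} (hg : ev w g.1 = g'.1)
    (hα : ev w α.1 = α'.1) :
    ev w (((repr T).bicat L c).whiskerL g α).1 = ((τ.bicat L c).whiskerL g' α').1 :=
  ev_eval (ev_whiskerLPair hg hα)

theorem ev_whiskerR {β : Hom2 g g₁} {β' : Hom2 g' g₁'} (hβ : ev w β.1 = β'.1)
    (hf : ev w f.1 = f'.1) :
    ev w (((repr T).bicat L c).whiskerR β f).1 = ((τ.bicat L c).whiskerR β' f').1 :=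
  ev_eval (ev_whiskerRPair hβ hf)

theorem ev_one (hg : ev w g.1 = g'.1) (hf : ev w f.1 = f'.1) :
    ev w (((repr T).bicat L c).one g f).1 = ((τ.bicat L c).one g' f').1 :=
  ev_eval (ev_homPair hg hf)

theorem ev_assoc (hh : ev w h.1 = h'.1) (hg : ev w g.1 = g'.1) (hf : ev w f.1 = f'.1) :
    ev w (((repr T).bicat L c).assoc h g f).1 = ((τ.bicat L c).assoc h' g' f').1 :=
  ev_eval (ev_homTriple hh hg hf)

theorem ev_assocInv (hh : ev w h.1 = h'.1) (hg : ev w g.1 = g'.1) (hf : ev w f.1 = f'.1) :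
    ev w (((repr T).bicat L c).assocInv h g f).1 = ((τ.bicat L c).assocInv h' g' f').1 :=
  ev_eval (ev_homTriple hh hg hf)

end

/-! ### Values of the functors, the transformation and the hexagon -/

section

variable {w : τ.functor.obj (op (Coh.mk T))} {x y z : (repr T).cell .X 0}
  {x' y' z' : τ.cell .X 0} {f f₁ : Hom x y} {g : Hom y z} {f' f₁' : Hom x' y'} {g' : Hom y' z'}
  (L : Liftings) (δ : Bool)

theorem ev_map1 (hf : ev w f.1 = f'.1) : ev w (f.fn δ).1 = (f'.fn δ).1 :=
  ev_fn δ hf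

theorem ev_map2 {α : Hom2 f f₁} {α' : Hom2 f' f₁'} (hα : ev w α.1 = α'.1) :
    ev w (((repr T).pseudofunctor L δ).map2 α).1 = ((τ.pseudofunctor L δ).map2 α').1 :=
  ev_fn δ hα

theorem ev_oneFn (hf : ev w f.1 = f'.1) :
    ev w (((repr T).pseudofunctor L δ).one f).1 = ((τ.pseudofunctor L δ).one f').1 :=
  ev_eval hf

theorem ev_d (hg : ev w g.1 = g'.1) (hf : ev w f.1 = f'.1) :
    ev w (((repr T).pseudofunctor L δ).d g f).1 = ((τ.pseudofunctor L δ).d g' f').1 :=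
  ev_eval (ev_homPair hg hf)

theorem ev_dInv (hg : ev w g.1 = g'.1) (hf : ev w f.1 = f'.1) :
    ev w (((repr T).pseudofunctor L δ).dInv g f).1 = ((τ.pseudofunctor L δ).dInv g' f').1 :=
  ev_eval (ev_homPair hg hf)

theorem ev_natHom (hx : ev w x = x') : ev w (natHom x).1 = (natHom x').1 :=
  ev_nat hx

theorem ev_oneNat (hx : ev w x = x') :
    ev w (((repr T).pseudonat L).one x).1 = ((τ.pseudonat L).one x').1 :=
  ev_eval hx

theorem ev_ω (hf : ev w f.1 = f'.1) :
    ev w (((repr T).pseudonat L).ω f).1 = ((τ.pseudonat L).ω f').1 :=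
  ev_eval hf

theorem ev_ωInv (hf : ev w f.1 = f'.1) :
    ev w (((repr T).pseudonat L).ωInv f).1 = ((τ.pseudonat L).ωInv f').1 :=
  ev_eval hf

/-- The value of an arrow determines the values of its endpoints, so these never need to be recorded
separately. -/
theorem ev_src (hf : ev w f.1 = f'.1) : ev w x = x' :=
  (congrArg (ev w) f.2.1).symm.trans ((ev_bd false hf).trans f'.2.1)

theorem ev_tgt (hf : ev w f.1 = f'.1) : ev w y = y' :=
  (congrArg (ev w) f.2.2).symm.trans ((ev_bd true hf).trans f'.2.2)

theorem ev_pathABCDEF (hg : ev w g.1 = g'.1) (hf : ev w f.1 = f'.1) :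
    ev w (((repr T).pseudonat L).pathABCDEF g f).1 = ((τ.pseudonat L).pathABCDEF g' f').1 := by
  have hy := ev_natHom (ev_tgt hf)
  have hz := ev_natHom (ev_tgt hg)
  exact ev_vcomp (ev_vcomp (ev_vcomp (ev_vcomp
    (ev_hcomp (ev_oneNat L (ev_tgt hg)) (ev_d L false hg hf))
    (ev_assocInv L hz (ev_map1 false hg) (ev_map1 false hf)))
    (ev_hcomp (ev_ω L hg) (ev_oneFn L false hf)))
    (ev_assoc L (ev_map1 true hg) hy (ev_map1 false hf)))
    (ev_hcomp (ev_oneFn L true hg) (ev_ω L hf))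

theorem ev_pathAGHF (hg : ev w g.1 = g'.1) (hf : ev w f.1 = f'.1) :
    ev w (((repr T).pseudonat L).pathAGHF g f).1 = ((τ.pseudonat L).pathAGHF g' f').1 := by
  have hx := ev_natHom (ev_src hf)
  exact ev_vcomp (ev_vcomp (ev_ω L (ev_hom_comp hg hf))
    (ev_hcomp (ev_d L true hg hf) (ev_oneNat L (ev_src hf))))
    (ev_assoc L (ev_map1 true hg) (ev_map1 true hf) hx)

end

/-! ### The 3-operation filling the hexagon -/

theorem exists_isLifting_hexagon (L : Liftings) :
    ∃ (P Q : PreOp (.chain .X (Nat.zero_le 1) 1) .Z 2)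
      (K : PreOp (.chain .X (Nat.zero_le 1) 1) .Z 3) (hK : PreOp.IsLifting P Q K),
      ∀ (τ : Model.{u}) (x y z : τ.cell .X 0) (b : Hom y z) (a : Hom x y),
        τ.eval P hK.left (homPair b a) = ((τ.pseudonat L).pathABCDEF b a).1 ∧
          τ.eval Q hK.right (homPair b a) = ((τ.pseudonat L).pathAGHF b a).1 := by
  let b := chainHomSucc .X (0 : Fin 1)
  let a := chainHom .X (0 : Fin 2)
  -- The common source of the two paths is a composite, which makes both paths algebraic.
  have alg := Hom.algebraic_comp (b.fn true) ((a.fn true).comp (natHom _))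
  obtain ⟨K, hK⟩ := exists_isLifting_of_hom2
    (alg.hom2 (((repr _).pseudonat L).pathABCDEF b a)) (alg.hom2 (((repr _).pseudonat L).pathAGHF b a))
  refine ⟨_, _, K, hK, fun τ x y z b' a' => ?_⟩
  -- The generic arrows are coprojections of the tree, whose values at a glued pair are the arrows
  -- of that pair.
  have hb : ev (homPair b' a') b.1 = b'.1 := 
    (ev_eq_eval _).trans (eval_homPair_one (ht := isOp_arr (1 : Fin 2)))
  have ha : ev (homPair b' a') a.1 = a'.1 := 
    (ev_eq_eval _).trans (eval_homPair_zero (ht := isOp_arr (0 : Fin 2)))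
  exact ⟨(ev_eq_eval _).symm.trans (ev_pathABCDEF L hb ha),
    (ev_eq_eval _).symm.trans (ev_pathAGHF L hb ha)⟩

end Model

namespace Model

/-! ### Generic pasting schemes -/

/-- The tree has the globes of dimensions `n l` as entries, glued along globes of dimensions `p l`.
Since a model sends its globular sum to a fibre product, the given cells form one element of this
shape, at which the coprojections take the given values. -/
theorem exists_generic {τ : Model.{u}} {c : Side} {k : ℕ} {n : Fin (k + 1) → ℕ} {p : Fin k → ℕ}
    (h : ∀ l, p l ≤ n l.castSucc) (h' : ∀ l, p l ≤ n l.succ) (x : ∀ l, τ.cell c (n l))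
    (hx : ∀ l, τ.bdTo true (h l) (x l.castSucc) = τ.bdTo false (h' l) (x l.succ)) :
    ∃ (T : Tree) (w : τ.functor.obj (op (Coh.mk T))) (v : ∀ l, (repr T).cell c (n l)),
      (∀ l, (repr T).bdTo true (h l) (v l.castSucc) = (repr T).bdTo false (h' l) (v l.succ)) ∧
        ∀ l, ev w (v l) = x l := by
  let T : Tree :=
    { len := k
      top := fun l => .glob c (n l)
      bot := fun l => .glob c (p l)
      tleg := fun l => .glob true c (h l)
      sleg := fun l => .glob false c (h' l) }
  exact ⟨T, τ.glue T x hx, Coh.incl T, repr_incl_glue T, fun l => map_incl_glue (T := T) l⟩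

variable {τ : Model.{u}} {c : Side}

theorem exists_generic_one {n : ℕ} (x : τ.cell c n) :
    ∃ (T : Tree) (w : τ.functor.obj (op (Coh.mk T))) (v : (repr T).cell c n), ev w v = x := by
  obtain ⟨T, w, v, -, hv⟩ := exists_generic (n := fun _ : Fin 1 => n) (p := fun _ => 0)
    (fun l => l.elim0) (fun l => l.elim0) (fun _ => x) fun l => l.elim0
  exact ⟨T, w, v 0, hv 0⟩

theorem exists_generic_two {n₀ n₁ p : ℕ} {h : p ≤ n₀} {h' : p ≤ n₁} {x₀ : τ.cell c n₀}
    {x₁ : τ.cell c n₁} (e : τ.bdTo true h x₀ = τ.bdTo false h' x₁) :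
    ∃ (T : Tree) (w : τ.functor.obj (op (Coh.mk T))) (v₀ : (repr T).cell c n₀)
      (v₁ : (repr T).cell c n₁), (repr T).bdTo true h v₀ = (repr T).bdTo false h' v₁ ∧
        ev w v₀ = x₀ ∧ ev w v₁ = x₁ := by
  obtain ⟨T, w, v, hv, hx⟩ := exists_generic (n := ![n₀, n₁]) (p := ![p])
    (Fin.cases (n := 0) h fun l => l.elim0) (Fin.cases (n := 0) h' fun l => l.elim0)
    (Fin.cases (motive := fun l : Fin 2 => τ.cell c (![n₀, n₁] l)) x₀
      (Fin.cases (n := 0) x₁ fun l => l.elim0))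
    (Fin.cases (n := 0) e fun l => l.elim0)
  exact ⟨T, w, v 0, v 1, hv 0, hx 0, hx 1⟩

theorem exists_generic_three {n₀ n₁ n₂ p₀ p₁ : ℕ} {h₀ : p₀ ≤ n₀} {h₀' : p₀ ≤ n₁} {h₁ : p₁ ≤ n₁}
    {h₁' : p₁ ≤ n₂} {x₀ : τ.cell c n₀} {x₁ : τ.cell c n₁} {x₂ : τ.cell c n₂}
    (e₀ : τ.bdTo true h₀ x₀ = τ.bdTo false h₀' x₁)
    (e₁ : τ.bdTo true h₁ x₁ = τ.bdTo false h₁' x₂) :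
    ∃ (T : Tree) (w : τ.functor.obj (op (Coh.mk T))) (v₀ : (repr T).cell c n₀)
      (v₁ : (repr T).cell c n₁) (v₂ : (repr T).cell c n₂),
      (repr T).bdTo true h₀ v₀ = (repr T).bdTo false h₀' v₁ ∧
      (repr T).bdTo true h₁ v₁ = (repr T).bdTo false h₁' v₂ ∧
        ev w v₀ = x₀ ∧ ev w v₁ = x₁ ∧ ev w v₂ = x₂ := by
  obtain ⟨T, w, v, hv, hx⟩ := exists_generic (n := ![n₀, n₁, n₂]) (p := ![p₀, p₁])
    (Fin.cases (n := 1) h₀ (Fin.cases (n := 0) h₁ fun l => l.elim0))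
    (Fin.cases (n := 1) h₀' (Fin.cases (n := 0) h₁' fun l => l.elim0))
    (Fin.cases (motive := fun l : Fin 3 => τ.cell c (![n₀, n₁, n₂] l)) x₀
      (Fin.cases (n := 1) x₁ (Fin.cases (n := 0) x₂ fun l => l.elim0)))
    (Fin.cases (n := 1) e₀ (Fin.cases (n := 0) e₁ fun l => l.elim0))
  exact ⟨T, w, v 0, v 1, v 2, hv 0, hv 1, hx 0, hx 1, hx 2⟩

theorem exists_generic_four {n₀ n₁ n₂ n₃ p₀ p₁ p₂ : ℕ} {h₀ : p₀ ≤ n₀} {h₀' : p₀ ≤ n₁}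
    {h₁ : p₁ ≤ n₁} {h₁' : p₁ ≤ n₂} {h₂ : p₂ ≤ n₂} {h₂' : p₂ ≤ n₃} {x₀ : τ.cell c n₀}
    {x₁ : τ.cell c n₁} {x₂ : τ.cell c n₂} {x₃ : τ.cell c n₃}
    (e₀ : τ.bdTo true h₀ x₀ = τ.bdTo false h₀' x₁)
    (e₁ : τ.bdTo true h₁ x₁ = τ.bdTo false h₁' x₂)
    (e₂ : τ.bdTo true h₂ x₂ = τ.bdTo false h₂' x₃) :
    ∃ (T : Tree) (w : τ.functor.obj (op (Coh.mk T))) (v₀ : (repr T).cell c n₀)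
      (v₁ : (repr T).cell c n₁) (v₂ : (repr T).cell c n₂) (v₃ : (repr T).cell c n₃),
      (repr T).bdTo true h₀ v₀ = (repr T).bdTo false h₀' v₁ ∧
      (repr T).bdTo true h₁ v₁ = (repr T).bdTo false h₁' v₂ ∧
      (repr T).bdTo true h₂ v₂ = (repr T).bdTo false h₂' v₃ ∧
        ev w v₀ = x₀ ∧ ev w v₁ = x₁ ∧ ev w v₂ = x₂ ∧ ev w v₃ = x₃ := by
  obtain ⟨T, w, v, hv, hx⟩ := exists_generic (n := ![n₀, n₁, n₂, n₃]) (p := ![p₀, p₁, p₂])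
    (Fin.cases (n := 2) h₀ (Fin.cases (n := 1) h₁ (Fin.cases (n := 0) h₂ fun l => l.elim0)))
    (Fin.cases (n := 2) h₀' (Fin.cases (n := 1) h₁' (Fin.cases (n := 0) h₂' fun l => l.elim0)))
    (Fin.cases (motive := fun l : Fin 4 => τ.cell c (![n₀, n₁, n₂, n₃] l)) x₀
      (Fin.cases (n := 2) x₁ (Fin.cases (n := 1) x₂ (Fin.cases (n := 0) x₃ fun l => l.elim0))))
    (Fin.cases (n := 2) e₀ (Fin.cases (n := 1) e₁ (Fin.cases (n := 0) e₂ fun l => l.elim0)))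
  exact ⟨T, w, v 0, v 1, v 2, v 3, hv 0, hv 1, hv 2, hx 0, hx 1, hx 2, hx 3⟩

/-- By globularity, the 0-source and 0-target of a 2-cell can be computed from either of its two
faces; 2-cells that share a face thus have the same endpoints. -/
theorem bdTo_zero_congr (ε : Bool) {δ δ' : Bool} {α β : τ.cell c 2}
    (h : τ.bd δ α = τ.bd δ' β) :
    τ.bdTo ε (Nat.zero_le 2) α = τ.bdTo ε (Nat.zero_le 2) β :=
  (bd_bd_eq_bdTo ε δ α).symm.trans ((congrArg _ h).trans (bd_bd_eq_bdTo ε δ' β))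

theorem Hom2.vcomp_ok {x y : τ.cell c 0} {f g h : Hom x y} (β : Hom2 g h) (α : Hom2 f g) :
    τ.bdTo true (Nat.le_succ 1) α.1 = τ.bdTo false (Nat.le_succ 1) β.1 :=
  α.2.2.trans β.2.1.symm

variable {x y z t s : τ.cell c 0} {f f₁ f₂ f₃ : Hom x y} {g g₁ g₂ : Hom y z} {h h₁ : Hom z t}

theorem exists_generic_hom (f : Hom x y) :
    ∃ (T : Tree) (w : τ.functor.obj (op (Coh.mk T))) (x' y' : (repr T).cell c 0)
      (f' : Hom x' y'), ev w f'.1 = f.1 := by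
  obtain ⟨T, w, a, ha⟩ := exists_generic_one f.1
  exact ⟨T, w, _, _, ⟨a, rfl, rfl⟩, ha⟩

/-- The pattern of this and the following lemmas, one for each pasting shape in the axioms: the tree
lists the cells in the order in which they are traversed, thus `f` before `g`. A shared endpoint is
taken from one of the adjacent cells, and the gluing relation gives the endpoint equation of the
other. Only the values of the maximal cells are recorded, as they determine those of all boundaries.
-/
theorem exists_generic_homPair (g : Hom y z) (f : Hom x y) :
    ∃ (T : Tree) (w : τ.functor.obj (op (Coh.mk T))) (x' y' z' : (repr T).cell c 0)
      (g' : Hom y' z') (f' : Hom x' y'), ev w g'.1 = g.1 ∧ ev w f'.1 = f.1 := by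
  obtain ⟨T, w, a, b, e, ha, hb⟩ := exists_generic_two (g.comp_ok f)
  exact ⟨T, w, _, _, _, ⟨b, e.symm, rfl⟩, ⟨a, rfl, rfl⟩, hb, ha⟩

theorem exists_generic_homTriple (h : Hom z t) (g : Hom y z) (f : Hom x y) :
    ∃ (T : Tree) (w : τ.functor.obj (op (Coh.mk T))) (x' y' z' t' : (repr T).cell c 0)
      (h' : Hom z' t') (g' : Hom y' z') (f' : Hom x' y'),
      ev w h'.1 = h.1 ∧ ev w g'.1 = g.1 ∧ ev w f'.1 = f.1 := by
  obtain ⟨T, w, a, b, d, e, e', ha, hb, hd⟩ := exists_generic_three (g.comp_ok f) (h.comp_ok g)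
  exact ⟨T, w, _, _, _, _, ⟨d, e'.symm, rfl⟩, ⟨b, e.symm, rfl⟩, ⟨a, rfl, rfl⟩, hd, hb, ha⟩

theorem exists_generic_homQuadruple (k : Hom t s) (h : Hom z t) (g : Hom y z) (f : Hom x y) :
    ∃ (T : Tree) (w : τ.functor.obj (op (Coh.mk T))) (x' y' z' t' s' : (repr T).cell c 0)
      (k' : Hom t' s') (h' : Hom z' t') (g' : Hom y' z') (f' : Hom x' y'),
      ev w k'.1 = k.1 ∧ ev w h'.1 = h.1 ∧ ev w g'.1 = g.1 ∧ ev w f'.1 = f.1 := by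
  obtain ⟨T, w, a, b, d, i, e, e', e'', ha, hb, hd, hi⟩ :=
    exists_generic_four (g.comp_ok f) (h.comp_ok g) (k.comp_ok h)
  exact ⟨T, w, _, _, _, _, _, ⟨i, e''.symm, rfl⟩, ⟨d, e'.symm, rfl⟩, ⟨b, e.symm, rfl⟩,
    ⟨a, rfl, rfl⟩, hi, hd, hb, ha⟩

theorem exists_generic_hom2 (α : Hom2 f f₁) :
    ∃ (T : Tree) (w : τ.functor.obj (op (Coh.mk T))) (x' y' : (repr T).cell c 0)
      (f' f₁' : Hom x' y') (α' : Hom2 f' f₁'), ev w α'.1 = α.1 := by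
  obtain ⟨T, w, a, ha⟩ := exists_generic_one α.1
  exact ⟨T, w, _, _, bdHom false a rfl rfl, bdHom true a rfl rfl, ⟨a, rfl, rfl⟩, ha⟩

theorem exists_generic_vcomp (β : Hom2 f₁ f₂) (α : Hom2 f f₁) :
    ∃ (T : Tree) (w : τ.functor.obj (op (Coh.mk T))) (x' y' : (repr T).cell c 0)
      (f' f₁' f₂' : Hom x' y') (β' : Hom2 f₁' f₂') (α' : Hom2 f' f₁'),
      ev w β'.1 = β.1 ∧ ev w α'.1 = α.1 := by
  obtain ⟨T, w, a, b, e, ha, hb⟩ := exists_generic_two (β.vcomp_ok α)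
  exact ⟨T, w, _, _, bdHom false a rfl rfl, bdHom true a rfl rfl,
    -- All three arrows must have the endpoints of `a`; those of `b` agree with them because the two
    -- 2-cells share a face.
    bdHom true b (bdTo_zero_congr _ e.symm) (bdTo_zero_congr _ e.symm),
    ⟨b, e.symm, rfl⟩, ⟨a, rfl, rfl⟩, hb, ha⟩

theorem exists_generic_vcompTriple (γ : Hom2 f₂ f₃) (β : Hom2 f₁ f₂) (α : Hom2 f f₁) :
    ∃ (T : Tree) (w : τ.functor.obj (op (Coh.mk T))) (x' y' : (repr T).cell c 0)
      (f' f₁' f₂' f₃' : Hom x' y') (γ' : Hom2 f₂' f₃') (β' : Hom2 f₁' f₂') (α' : Hom2 f' f₁'),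
      ev w γ'.1 = γ.1 ∧ ev w β'.1 = β.1 ∧ ev w α'.1 = α.1 := by
  obtain ⟨T, w, a, b, d, e, e', ha, hb, hd⟩ :=
    exists_generic_three (β.vcomp_ok α) (γ.vcomp_ok β)
  have h (ε) := bdTo_zero_congr ε e.symm
  have h' (ε) := (bdTo_zero_congr ε e'.symm).trans (h ε)
  exact ⟨T, w, _, _, bdHom false a rfl rfl, bdHom true a rfl rfl, bdHom true b (h _) (h _),
    bdHom true d (h' _) (h' _), ⟨d, e'.symm, rfl⟩, ⟨b, e.symm, rfl⟩, ⟨a, rfl, rfl⟩, hd, hb, ha⟩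

theorem exists_generic_hcomp (β : Hom2 g g₁) (α : Hom2 f f₁) :
    ∃ (T : Tree) (w : τ.functor.obj (op (Coh.mk T))) (x' y' z' : (repr T).cell c 0)
      (g' g₁' : Hom y' z') (f' f₁' : Hom x' y') (β' : Hom2 g' g₁') (α' : Hom2 f' f₁'),
      ev w β'.1 = β.1 ∧ ev w α'.1 = α.1 := by
  obtain ⟨T, w, a, b, e, ha, hb⟩ := exists_generic_two (α.bdTo_tgt.trans β.bdTo_src.symm)
  exact ⟨T, w, _, _, _, bdHom false b e.symm rfl, bdHom true b e.symm rfl, bdHom false a rfl rfl,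
    bdHom true a rfl rfl, ⟨b, rfl, rfl⟩, ⟨a, rfl, rfl⟩, hb, ha⟩

/-- The four 2-cells form a single tree in the order `α`, `α₁`, `β`, `β₁`, glued successively along
a 1-cell, a 0-cell and a 1-cell. -/
theorem exists_generic_interchange (β₁ : Hom2 g₁ g₂) (β : Hom2 g g₁) (α₁ : Hom2 f₁ f₂)
    (α : Hom2 f f₁) :
    ∃ (T : Tree) (w : τ.functor.obj (op (Coh.mk T))) (x' y' z' : (repr T).cell c 0)
      (g' g₁' g₂' : Hom y' z') (f' f₁' f₂' : Hom x' y') (β₁' : Hom2 g₁' g₂') (β' : Hom2 g' g₁')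
      (α₁' : Hom2 f₁' f₂') (α' : Hom2 f' f₁'),
      ev w β₁'.1 = β₁.1 ∧ ev w β'.1 = β.1 ∧ ev w α₁'.1 = α₁.1 ∧ ev w α'.1 = α.1 := by
  obtain ⟨T, w, a, a', b, b', e, e', e'', ha, ha', hb, hb'⟩ := exists_generic_four
    (α₁.vcomp_ok α) (α₁.bdTo_tgt.trans β.bdTo_src.symm) (β₁.vcomp_ok β)
  have h (ε) := bdTo_zero_congr ε e.symm
  have h' (ε) := bdTo_zero_congr ε e''.symm
  -- The 0-dimensional gluing joins `b` to `a'`, whereas the middle 0-cell is expressed through `a`;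
  -- the two descriptions agree because `a` and `a'` share a face.
  have k := e'.symm.trans (h _)
  exact ⟨T, w, _, _, _, bdHom false b k rfl, bdHom true b k rfl,
    bdHom true b' ((h' _).trans k) (h' _), bdHom false a rfl rfl, bdHom true a rfl rfl,
    bdHom true a' (h _) (h _), ⟨b', e''.symm, rfl⟩, ⟨b, rfl, rfl⟩, ⟨a', e.symm, rfl⟩,
    ⟨a, rfl, rfl⟩, hb', hb, ha', ha⟩

theorem exists_generic_whiskerL (g : Hom y z) (α : Hom2 f f₁) :
    ∃ (T : Tree) (w : τ.functor.obj (op (Coh.mk T))) (x' y' z' : (repr T).cell c 0)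
      (g' : Hom y' z') (f' f₁' : Hom x' y') (α' : Hom2 f' f₁'),
      ev w g'.1 = g.1 ∧ ev w α'.1 = α.1 := by
  obtain ⟨T, w, a, b, e, ha, hb⟩ := exists_generic_two
    (h' := Nat.zero_le 1) (α.bdTo_tgt.trans g.2.1.symm)
  exact ⟨T, w, _, _, _, ⟨b, e.symm, rfl⟩, bdHom false a rfl rfl, bdHom true a rfl rfl,
    ⟨a, rfl, rfl⟩, hb, ha⟩

theorem exists_generic_whiskerR (β : Hom2 g g₁) (f : Hom x y) :
    ∃ (T : Tree) (w : τ.functor.obj (op (Coh.mk T))) (x' y' z' : (repr T).cell c 0)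
      (g' g₁' : Hom y' z') (β' : Hom2 g' g₁') (f' : Hom x' y'),
      ev w β'.1 = β.1 ∧ ev w f'.1 = f.1 := by
  obtain ⟨T, w, a, b, e, ha, hb⟩ := exists_generic_two
    (h := Nat.zero_le 1) (f.2.2.trans β.bdTo_src.symm)
  exact ⟨T, w, _, _, _, bdHom false b e.symm rfl, bdHom true b e.symm rfl, ⟨b, rfl, rfl⟩,
    ⟨a, rfl, rfl⟩, hb, ha⟩

theorem exists_generic_whiskerL_vcomp (g : Hom y z) (α₁ : Hom2 f₁ f₂) (α : Hom2 f f₁) :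
    ∃ (T : Tree) (w : τ.functor.obj (op (Coh.mk T))) (x' y' z' : (repr T).cell c 0)
      (g' : Hom y' z') (f' f₁' f₂' : Hom x' y') (α₁' : Hom2 f₁' f₂') (α' : Hom2 f' f₁'),
      ev w g'.1 = g.1 ∧ ev w α₁'.1 = α₁.1 ∧ ev w α'.1 = α.1 := by
  obtain ⟨T, w, a, a', b, e, e', ha, ha', hb⟩ := exists_generic_three
    (α₁.vcomp_ok α) (h₁' := Nat.zero_le 1) (α₁.bdTo_tgt.trans g.2.1.symm)
  have h (ε) := bdTo_zero_congr ε e.symm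
  exact ⟨T, w, _, _, _, ⟨b, e'.symm.trans (h _), rfl⟩, bdHom false a rfl rfl,
    bdHom true a rfl rfl, bdHom true a' (h _) (h _), ⟨a', e.symm, rfl⟩, ⟨a, rfl, rfl⟩, hb, ha', ha⟩

theorem exists_generic_whiskerR_vcomp (β₁ : Hom2 g₁ g₂) (β : Hom2 g g₁) (f : Hom x y) :
    ∃ (T : Tree) (w : τ.functor.obj (op (Coh.mk T))) (x' y' z' : (repr T).cell c 0)
      (g' g₁' g₂' : Hom y' z') (β₁' : Hom2 g₁' g₂') (β' : Hom2 g' g₁') (f' : Hom x' y'),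
      ev w β₁'.1 = β₁.1 ∧ ev w β'.1 = β.1 ∧ ev w f'.1 = f.1 := by
  obtain ⟨T, w, a, b, b', e, e', ha, hb, hb'⟩ := exists_generic_three
    (h₀ := Nat.zero_le 1) (f.2.2.trans β.bdTo_src.symm) (β₁.vcomp_ok β)
  have h (ε) := bdTo_zero_congr ε e'.symm
  exact ⟨T, w, _, _, _, bdHom false b e.symm rfl, bdHom true b e.symm rfl,
    bdHom true b' ((h _).trans e.symm) (h _), ⟨b', e'.symm, rfl⟩, ⟨b, rfl, rfl⟩, ⟨a, rfl, rfl⟩,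
    hb', hb, ha⟩

theorem exists_generic_assoc_left (γ : Hom2 h h₁) (g : Hom y z) (f : Hom x y) :
    ∃ (T : Tree) (w : τ.functor.obj (op (Coh.mk T))) (x' y' z' t' : (repr T).cell c 0)
      (h' h₁' : Hom z' t') (γ' : Hom2 h' h₁') (g' : Hom y' z') (f' : Hom x' y'),
      ev w γ'.1 = γ.1 ∧ ev w g'.1 = g.1 ∧ ev w f'.1 = f.1 := by
  obtain ⟨T, w, a, b, d, e, e', ha, hb, hd⟩ := exists_generic_three (g.comp_ok f)
    (h₁ := Nat.zero_le 1) (g.2.2.trans γ.bdTo_src.symm)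
  exact ⟨T, w, _, _, _, _, bdHom false d e'.symm rfl, bdHom true d e'.symm rfl, ⟨d, rfl, rfl⟩,
    ⟨b, e.symm, rfl⟩, ⟨a, rfl, rfl⟩, hd, hb, ha⟩

theorem exists_generic_assoc_middle (h : Hom z t) (β : Hom2 g g₁) (f : Hom x y) :
    ∃ (T : Tree) (w : τ.functor.obj (op (Coh.mk T))) (x' y' z' t' : (repr T).cell c 0)
      (h' : Hom z' t') (g' g₁' : Hom y' z') (β' : Hom2 g' g₁') (f' : Hom x' y'),
      ev w h'.1 = h.1 ∧ ev w β'.1 = β.1 ∧ ev w f'.1 = f.1 := by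
  obtain ⟨T, w, a, b, d, e, e', ha, hb, hd⟩ := exists_generic_three
    (h₀ := Nat.zero_le 1) (h₁' := Nat.zero_le 1) (f.2.2.trans β.bdTo_src.symm)
    (β.bdTo_tgt.trans h.2.1.symm)
  exact ⟨T, w, _, _, _, _, ⟨d, e'.symm, rfl⟩, bdHom false b e.symm rfl, bdHom true b e.symm rfl,
    ⟨b, rfl, rfl⟩, ⟨a, rfl, rfl⟩, hd, hb, ha⟩

theorem exists_generic_assoc_right (h : Hom z t) (g : Hom y z) (α : Hom2 f f₁) :
    ∃ (T : Tree) (w : τ.functor.obj (op (Coh.mk T))) (x' y' z' t' : (repr T).cell c 0)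
      (h' : Hom z' t') (g' : Hom y' z') (f' f₁' : Hom x' y') (α' : Hom2 f' f₁'),
      ev w h'.1 = h.1 ∧ ev w g'.1 = g.1 ∧ ev w α'.1 = α.1 := by
  obtain ⟨T, w, a, b, d, e, e', ha, hb, hd⟩ := exists_generic_three
    (h₀' := Nat.zero_le 1) (α.bdTo_tgt.trans g.2.1.symm) (h.comp_ok g)
  exact ⟨T, w, _, _, _, _, ⟨d, e'.symm, rfl⟩, ⟨b, e.symm, rfl⟩, bdHom false a rfl rfl,
    bdHom true a rfl rfl, ⟨a, rfl, rfl⟩, hd, hb, ha⟩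

end Model

namespace Model

variable {τ : Model.{u}} {T : Tree} {c : Side}

/-! ### Boundaries of generic cells and comparison of values -/

section

variable {w : τ.functor.obj (op (Coh.mk T))} {x y : (repr T).cell c 0} {x' y' : τ.cell c 0}
  {f f₁ : Hom x y} {f' f₁' : Hom x' y'} {α : Hom2 f f₁} {α' : Hom2 f' f₁'}

theorem ev_dom (hα : ev w α.1 = α'.1) : ev w f.1 = f'.1 :=
  (congrArg (ev w) α.2.1).symm.trans ((ev_bd false hα).trans α'.2.1)

theorem ev_cod (hα : ev w α.1 = α'.1) : ev w f₁.1 = f₁'.1 :=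
  (congrArg (ev w) α.2.2).symm.trans ((ev_bd true hα).trans α'.2.2)

/-- A variant of `eq_of_ev` for `2`-cells between algebraic arrows. -/
theorem eq_of_ev_hom (hτ : τ.HasDim 2) {P Q : Hom2 f f₁} {α β : Hom2 f' f₁'}
    (hα : ev w P.1 = α.1) (hβ : ev w Q.1 = β.1) (hf : f.Algebraic) : α = β :=
  eq_of_ev hτ (hf.hom2 P) (hf.hom2 Q) hα hβ

end

/-! ### Models of dimension `2` -/

/-- Every axiom follows one scheme: replace the cells by generic ones, compute the value of each
side along its syntax, and conclude from the algebraicity of the two generic sides. Apart from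
`vassoc`, the common source is a composite of arrows, hence algebraic. -/
theorem isBicategory (hτ : τ.HasDim 2) (L : Liftings) (c : Side) :
    (τ.bicat L c).IsBicategory where
  vassoc γ β α := by
    obtain ⟨T, w, x, y, f, g, h, k, γ', β', α', hγ, hβ, hα⟩ := exists_generic_vcompTriple γ β α
    -- The source of the generic 2-cells is a cell of the tree, so the algebraicity is that of the
    -- vertical composites themselves.
    exact eq_of_ev hτ (Hom2.algebraic_vcomp _ _) (Hom2.algebraic_vcomp _ _)
      (ev_vcomp (ev_vcomp hγ hβ) hα) (ev_vcomp hγ (ev_vcomp hβ hα))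
  interchange β₁ β α₁ α := by
    obtain ⟨T, w, x, y, z, g, g₁, g₂, f, f₁, f₂, β₁', β', α₁', α', hβ₁, hβ, hα₁, hα⟩ :=
      exists_generic_interchange β₁ β α₁ α
    exact eq_of_ev_hom hτ (ev_hcomp (ev_vcomp hβ₁ hβ) (ev_vcomp hα₁ hα))
      (ev_vcomp (ev_hcomp hβ₁ hα₁) (ev_hcomp hβ hα)) (Hom.algebraic_comp _ _)
  hcomp_eq β α := by
    obtain ⟨T, w, x, y, z, g, g₁, f, f₁, β', α', hβ, hα⟩ := exists_generic_hcomp β α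
    exact eq_of_ev_hom hτ (ev_hcomp hβ hα)
      (ev_vcomp (ev_whiskerR L hβ (ev_cod hα)) (ev_whiskerL L (ev_dom hβ) hα))
      (Hom.algebraic_comp _ _)
  hcomp_eq' β α := by
    obtain ⟨T, w, x, y, z, g, g₁, f, f₁, β', α', hβ, hα⟩ := exists_generic_hcomp β α
    exact eq_of_ev_hom hτ (ev_hcomp hβ hα)
      (ev_vcomp (ev_whiskerL L (ev_cod hβ) hα) (ev_whiskerR L hβ (ev_dom hα)))
      (Hom.algebraic_comp _ _)
  whiskerL_vcomp g _ _ _ α₁ α := by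
    obtain ⟨T, w, x, y, z, g', f, f₁, f₂, α₁', α', hg, hα₁, hα⟩ :=
      exists_generic_whiskerL_vcomp g α₁ α
    exact eq_of_ev_hom hτ (ev_whiskerL L hg (ev_vcomp hα₁ hα))
      (ev_vcomp (ev_whiskerL L hg hα₁) (ev_whiskerL L hg hα)) (Hom.algebraic_comp _ _)
  whiskerR_vcomp β₁ β f := by
    obtain ⟨T, w, x, y, z, g, g₁, g₂, β₁', β', f', hβ₁, hβ, hf⟩ :=
      exists_generic_whiskerR_vcomp β₁ β f
    exact eq_of_ev_hom hτ (ev_whiskerR L (ev_vcomp hβ₁ hβ) hf)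
      (ev_vcomp (ev_whiskerR L hβ₁ hf) (ev_whiskerR L hβ hf)) (Hom.algebraic_comp _ _)
  one_one g f := by
    obtain ⟨T, w, x, y, z, g', f', hg, hf⟩ := exists_generic_homPair g f
    exact eq_of_ev_hom hτ (ev_vcomp (ev_one L hg hf) (ev_one L hg hf)) (ev_one L hg hf)
      (Hom.algebraic_comp _ _)
  one_whiskerL g _ _ α := by
    obtain ⟨T, w, x, y, z, g', f, f₁, α', hg, hα⟩ := exists_generic_whiskerL g α
    exact eq_of_ev_hom hτ (ev_vcomp (ev_one L hg (ev_cod hα)) (ev_whiskerL L hg hα))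
      (ev_whiskerL L hg hα) (Hom.algebraic_comp _ _)
  whiskerL_one g _ _ α := by
    obtain ⟨T, w, x, y, z, g', f, f₁, α', hg, hα⟩ := exists_generic_whiskerL g α
    exact eq_of_ev_hom hτ (ev_vcomp (ev_whiskerL L hg hα) (ev_one L hg (ev_dom hα)))
      (ev_whiskerL L hg hα) (Hom.algebraic_comp _ _)
  one_whiskerR β f := by
    obtain ⟨T, w, x, y, z, g, g₁, β', f', hβ, hf⟩ := exists_generic_whiskerR β f
    exact eq_of_ev_hom hτ (ev_vcomp (ev_one L (ev_cod hβ) hf) (ev_whiskerR L hβ hf))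
      (ev_whiskerR L hβ hf) (Hom.algebraic_comp _ _)
  whiskerR_one β f := by
    obtain ⟨T, w, x, y, z, g, g₁, β', f', hβ, hf⟩ := exists_generic_whiskerR β f
    exact eq_of_ev_hom hτ (ev_vcomp (ev_whiskerR L hβ hf) (ev_one L (ev_dom hβ) hf))
      (ev_whiskerR L hβ hf) (Hom.algebraic_comp _ _)
  assoc_assocInv h g f := by
    obtain ⟨T, w, x, y, z, t, h', g', f', hh, hg, hf⟩ := exists_generic_homTriple h g f
    exact eq_of_ev_hom hτ (ev_vcomp (ev_assoc L hh hg hf) (ev_assocInv L hh hg hf))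
      (ev_one L (ev_hom_comp hh hg) hf) (Hom.algebraic_comp _ _)
  assocInv_assoc h g f := by
    obtain ⟨T, w, x, y, z, t, h', g', f', hh, hg, hf⟩ := exists_generic_homTriple h g f
    exact eq_of_ev_hom hτ (ev_vcomp (ev_assocInv L hh hg hf) (ev_assoc L hh hg hf))
      (ev_one L hh (ev_hom_comp hg hf)) (Hom.algebraic_comp _ _)
  assoc_one h g f := by
    obtain ⟨T, w, x, y, z, t, h', g', f', hh, hg, hf⟩ := exists_generic_homTriple h g f
    exact eq_of_ev_hom hτ (ev_vcomp (ev_assoc L hh hg hf) (ev_one L hh (ev_hom_comp hg hf)))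
      (ev_assoc L hh hg hf) (Hom.algebraic_comp _ _)
  one_assocInv h g f := by
    obtain ⟨T, w, x, y, z, t, h', g', f', hh, hg, hf⟩ := exists_generic_homTriple h g f
    exact eq_of_ev_hom hτ (ev_vcomp (ev_one L hh (ev_hom_comp hg hf)) (ev_assocInv L hh hg hf))
      (ev_assocInv L hh hg hf) (Hom.algebraic_comp _ _)
  assoc_natural_left γ g f := by
    obtain ⟨T, w, x, y, z, t, h, h₁, γ', g', f', hγ, hg, hf⟩ := exists_generic_assoc_left γ g f
    exact eq_of_ev_hom hτ
      (ev_vcomp (ev_assoc L (ev_cod hγ) hg hf) (ev_whiskerR L hγ (ev_hom_comp hg hf)))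
      (ev_vcomp (ev_whiskerR L (ev_whiskerR L hγ hg) hf) (ev_assoc L (ev_dom hγ) hg hf))
      (Hom.algebraic_comp _ _)
  assoc_natural_middle h _ _ β f := by
    obtain ⟨T, w, x, y, z, t, h', g, g₁, β', f', hh, hβ, hf⟩ := exists_generic_assoc_middle h β f
    exact eq_of_ev_hom hτ
      (ev_vcomp (ev_assoc L hh (ev_cod hβ) hf) (ev_whiskerL L hh (ev_whiskerR L hβ hf)))
      (ev_vcomp (ev_whiskerR L (ev_whiskerL L hh hβ) hf) (ev_assoc L hh (ev_dom hβ) hf))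
      (Hom.algebraic_comp _ _)
  assoc_natural_right h g _ _ α := by
    obtain ⟨T, w, x, y, z, t, h', g', f, f₁, α', hh, hg, hα⟩ := exists_generic_assoc_right h g α
    exact eq_of_ev_hom hτ
      (ev_vcomp (ev_assoc L hh hg (ev_cod hα)) (ev_whiskerL L hh (ev_whiskerL L hg hα)))
      (ev_vcomp (ev_whiskerL L (ev_hom_comp hh hg) hα) (ev_assoc L hh hg (ev_dom hα)))
      (Hom.algebraic_comp _ _)
  pentagon k h g f := by
    obtain ⟨T, w, x, y, z, t, s, k', h', g', f', hk, hh, hg, hf⟩ :=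
      exists_generic_homQuadruple k h g f
    exact eq_of_ev_hom hτ
      (ev_vcomp (ev_assoc L (ev_hom_comp hk hh) hg hf) (ev_assoc L hk hh (ev_hom_comp hg hf)))
      (ev_vcomp (ev_whiskerR L (ev_assoc L hk hh hg) hf)
        (ev_vcomp (ev_assoc L hk (ev_hom_comp hh hg) hf) (ev_whiskerL L hk (ev_assoc L hh hg hf))))
      (Hom.algebraic_comp _ _)

/-- Both sides of each axiom lie in `Z`, and their common source is a value of the functor or a
composite of such values. It is algebraic even when the arrow to which the functor is applied is a
cell of the tree, which is why the unit laws hold for all 2-cells in the image of the functor. -/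
theorem isPseudofunctor (hτ : τ.HasDim 2) (L : Liftings) (δ : Bool) :
    (τ.pseudofunctor L δ).IsPseudofunctor where
  map2_vcomp β α := by
    obtain ⟨T, w, x, y, f, f₁, f₂, β', α', hβ, hα⟩ := exists_generic_vcomp β α
    exact eq_of_ev_hom hτ (ev_map2 L δ (ev_vcomp hβ hα))
      (ev_vcomp (ev_map2 L δ hβ) (ev_map2 L δ hα)) (Hom.algebraic_fn δ _)
  one_one f := by
    obtain ⟨T, w, x, y, f', hf⟩ := exists_generic_hom f
    exact eq_of_ev_hom hτ (ev_vcomp (ev_oneFn L δ hf) (ev_oneFn L δ hf)) (ev_oneFn L δ hf)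
      (Hom.algebraic_fn δ _)
  one_map2 α := by
    obtain ⟨T, w, x, y, f, f₁, α', hα⟩ := exists_generic_hom2 α
    exact eq_of_ev_hom hτ (ev_vcomp (ev_oneFn L δ (ev_cod hα)) (ev_map2 L δ hα))
      (ev_map2 L δ hα) (Hom.algebraic_fn δ _)
  map2_one α := by
    obtain ⟨T, w, x, y, f, f₁, α', hα⟩ := exists_generic_hom2 α
    exact eq_of_ev_hom hτ (ev_vcomp (ev_map2 L δ hα) (ev_oneFn L δ (ev_dom hα)))
      (ev_map2 L δ hα) (Hom.algebraic_fn δ _)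
  one_comp g f := by
    obtain ⟨T, w, x, y, z, g', f', hg, hf⟩ := exists_generic_homPair g f
    exact eq_of_ev_hom hτ (ev_map2 L δ (ev_one L hg hf)) (ev_oneFn L δ (ev_hom_comp hg hf))
      (Hom.algebraic_fn δ _)
  one_hcomp_one g f := by
    obtain ⟨T, w, x, y, z, g', f', hg, hf⟩ := exists_generic_homPair g f
    exact eq_of_ev_hom hτ (ev_hcomp (ev_oneFn L δ hg) (ev_oneFn L δ hf))
      (ev_one L (ev_map1 δ hg) (ev_map1 δ hf)) (Hom.algebraic_comp _ _)
  d_dInv g f := by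
    obtain ⟨T, w, x, y, z, g', f', hg, hf⟩ := exists_generic_homPair g f
    exact eq_of_ev_hom hτ (ev_vcomp (ev_d L δ hg hf) (ev_dInv L δ hg hf))
      (ev_oneFn L δ (ev_hom_comp hg hf)) (Hom.algebraic_fn δ _)
  dInv_d g f := by
    obtain ⟨T, w, x, y, z, g', f', hg, hf⟩ := exists_generic_homPair g f
    exact eq_of_ev_hom hτ (ev_vcomp (ev_dInv L δ hg hf) (ev_d L δ hg hf))
      (ev_one L (ev_map1 δ hg) (ev_map1 δ hf)) (Hom.algebraic_comp _ _)
  one_d g f := by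
    obtain ⟨T, w, x, y, z, g', f', hg, hf⟩ := exists_generic_homPair g f
    exact eq_of_ev_hom hτ (ev_vcomp (ev_oneFn L δ (ev_hom_comp hg hf)) (ev_d L δ hg hf))
      (ev_d L δ hg hf) (Hom.algebraic_comp _ _)
  dInv_one g f := by
    obtain ⟨T, w, x, y, z, g', f', hg, hf⟩ := exists_generic_homPair g f
    exact eq_of_ev_hom hτ (ev_vcomp (ev_dInv L δ hg hf) (ev_oneFn L δ (ev_hom_comp hg hf)))
      (ev_dInv L δ hg hf) (Hom.algebraic_fn δ _)
  d_natural_left β f := by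
    obtain ⟨T, w, x, y, z, g, g₁, β', f', hβ, hf⟩ := exists_generic_whiskerR β f
    exact eq_of_ev_hom hτ
      (ev_vcomp (ev_d L δ (ev_cod hβ) hf) (ev_hcomp (ev_map2 L δ hβ) (ev_oneFn L δ hf)))
      (ev_vcomp (ev_map2 L δ (ev_whiskerR L hβ hf)) (ev_d L δ (ev_dom hβ) hf))
      (Hom.algebraic_comp _ _)
  d_natural_right g _ _ α := by
    obtain ⟨T, w, x, y, z, g', f, f₁, α', hg, hα⟩ := exists_generic_whiskerL g α
    exact eq_of_ev_hom hτ
      (ev_vcomp (ev_d L δ hg (ev_cod hα)) (ev_hcomp (ev_oneFn L δ hg) (ev_map2 L δ hα)))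
      (ev_vcomp (ev_map2 L δ (ev_whiskerL L hg hα)) (ev_d L δ hg (ev_dom hα)))
      (Hom.algebraic_comp _ _)
  map2_assoc h g f := by
    obtain ⟨T, w, x, y, z, t, h', g', f', hh, hg, hf⟩ := exists_generic_homTriple h g f
    exact eq_of_ev_hom hτ
      (ev_vcomp (ev_map2 L δ (ev_assoc L hh hg hf)) (ev_vcomp (ev_d L δ hh (ev_hom_comp hg hf))
        (ev_hcomp (ev_oneFn L δ hh) (ev_d L δ hg hf))))
      (ev_vcomp (ev_d L δ (ev_hom_comp hh hg) hf) (ev_vcomp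
        (ev_hcomp (ev_d L δ hh hg) (ev_oneFn L δ hf))
        (ev_assoc L (ev_map1 δ hh) (ev_map1 δ hg) (ev_map1 δ hf))))
      (Hom.algebraic_comp _ _)

/-- The same scheme; the common sources are components of the transformation and composites of these
with values of the functors. The hexagon needs no separate treatment: its two paths are parallel
2-cells out of a composite. -/
theorem isPseudonatural (hτ : τ.HasDim 2) (L : Liftings) : (τ.pseudonat L).IsPseudonatural where
  one_one x := by
    obtain ⟨T, w, x', hx⟩ := exists_generic_one x
    exact eq_of_ev_hom hτ (ev_vcomp (ev_oneNat L hx) (ev_oneNat L hx)) (ev_oneNat L hx)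
      (algebraic_natHom _)
  one_hcomp_one a := by
    obtain ⟨T, w, x, y, a', ha⟩ := exists_generic_hom a
    exact eq_of_ev_hom hτ (ev_hcomp (ev_oneFn L true ha) (ev_oneNat L (ev_src ha)))
      (ev_one L (ev_map1 true ha) (ev_natHom (ev_src ha))) (Hom.algebraic_comp _ _)
  one_hcomp_one' a := by
    obtain ⟨T, w, x, y, a', ha⟩ := exists_generic_hom a
    exact eq_of_ev_hom hτ (ev_hcomp (ev_oneNat L (ev_tgt ha)) (ev_oneFn L false ha))
      (ev_one L (ev_natHom (ev_tgt ha)) (ev_map1 false ha)) (Hom.algebraic_comp _ _)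
  ω_ωInv a := by
    obtain ⟨T, w, x, y, a', ha⟩ := exists_generic_hom a
    exact eq_of_ev_hom hτ (ev_vcomp (ev_ω L ha) (ev_ωInv L ha))
      (ev_one L (ev_natHom (ev_tgt ha)) (ev_map1 false ha)) (Hom.algebraic_comp _ _)
  ωInv_ω a := by
    obtain ⟨T, w, x, y, a', ha⟩ := exists_generic_hom a
    exact eq_of_ev_hom hτ (ev_vcomp (ev_ωInv L ha) (ev_ω L ha))
      (ev_one L (ev_map1 true ha) (ev_natHom (ev_src ha))) (Hom.algebraic_comp _ _)
  ω_one a := by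
    obtain ⟨T, w, x, y, a', ha⟩ := exists_generic_hom a
    exact eq_of_ev_hom hτ
      (ev_vcomp (ev_ω L ha) (ev_one L (ev_map1 true ha) (ev_natHom (ev_src ha))))
      (ev_ω L ha) (Hom.algebraic_comp _ _)
  one_ωInv a := by
    obtain ⟨T, w, x, y, a', ha⟩ := exists_generic_hom a
    exact eq_of_ev_hom hτ
      (ev_vcomp (ev_one L (ev_map1 true ha) (ev_natHom (ev_src ha))) (ev_ωInv L ha))
      (ev_ωInv L ha) (Hom.algebraic_comp _ _)
  ω_natural α := by
    obtain ⟨T, w, x, y, a, a', α', hα⟩ := exists_generic_hom2 α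
    exact eq_of_ev_hom hτ
      (ev_vcomp (ev_ω L (ev_cod hα))
        (ev_hcomp (ev_map2 L true hα) (ev_oneNat L (ev_src (ev_dom hα)))))
      (ev_vcomp (ev_hcomp (ev_oneNat L (ev_tgt (ev_dom hα))) (ev_map2 L false hα))
        (ev_ω L (ev_dom hα))) (Hom.algebraic_comp _ _)
  hexagon b a := by
    obtain ⟨T, w, x, y, z, b', a', hb, ha⟩ := exists_generic_homPair b a
    exact eq_of_ev_hom hτ (ev_pathABCDEF L hb ha) (ev_pathAGHF L hb ha) (Hom.algebraic_comp _ _)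

end Model
end WeakTrans

theorem mainTheorem1 :
    Nonempty WeakTrans.Liftings ∧
    ∀ L : WeakTrans.Liftings,
      (∃ (P Q : WeakTrans.PreOp (.chain .X (Nat.zero_le 1) 1) .Z 2)
        (K : WeakTrans.PreOp (.chain .X (Nat.zero_le 1) 1) .Z 3)
        (hK : WeakTrans.PreOp.IsLifting P Q K),
        ∀ (τ : WeakTrans.Model.{u}) (x y z : τ.cell .X 0) (b : WeakTrans.Model.Hom y z)
          (a : WeakTrans.Model.Hom x y),
          τ.eval P hK.left (WeakTrans.Model.homPair b a) =
              ((τ.pseudonat L).pathABCDEF b a).1 ∧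
            τ.eval Q hK.right (WeakTrans.Model.homPair b a) =
              ((τ.pseudonat L).pathAGHF b a).1) ∧
      ∀ τ : WeakTrans.Model.{u}, τ.HasDim 2 →
        (τ.bicat L .X).IsBicategory ∧ (τ.bicat L .Z).IsBicategory ∧
        (τ.pseudofunctor L false).IsPseudofunctor ∧ (τ.pseudofunctor L true).IsPseudofunctor ∧
        (τ.pseudonat L).IsPseudonatural :=
  ⟨WeakTrans.Model.nonempty_liftings, fun L =>
    ⟨WeakTrans.Model.exists_isLifting_hexagon L, fun _ hτ =>
      ⟨WeakTrans.Model.isBicategory hτ L .X, WeakTrans.Model.isBicategory hτ L .Z,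
        WeakTrans.Model.isPseudofunctor hτ L false, WeakTrans.Model.isPseudofunctor hτ L true,
        WeakTrans.Model.isPseudonatural hτ L⟩⟩⟩
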